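/- Let $n\ge 2$ and $\mathcal N=\{1,\dots,n\}$. Vectors are compared componentwise, $x>y$ means $x_i>y_i$ for all $i$, and $\mathbb R^n_+$ is the set of vectors with nonnegative entries. For $A=[a_{i,j}]\in\mathbb C^{n\times n}$ write $|D(A)|e=(|a_{1,1}|,\dots,|a_{n,n}|)^T$. $\mathcal F_n$ is the set of functions $f=[f_1,\dots,f_n]^T:\mathbb C^{n\times n}\to\mathbb R^n_+$ such that each $f_k(A)$ depends only on the moduli of the off-diagonal entries of $A$. $\mathcal G_n$ (the $G$-functions) is the set of those $f\in\mathcal F_n$ such that, for every $A\in\mathbb C^{n\times n}$, $|D(A)|e>f(A)$ implies that $A$ is nonsingular. A function $F:\mathbb R^n_+\times\mathbb R^n_+\to\mathbb R^m_+$ is monotonic if $F(x,y)\ge F(u,v)$ whenever $x\ge u\ge 0$ and $y\ge v\ge 0$. The set $\mathcal G^F$ of $G$-function pairs induced by $F$ consists of the pairs $(g,h)\in\mathcal F_n\times\mathcal F_n$ such that, for every $A\in\mathbb C^{n\times n}$, $F(|D(A)|e,|D(A)|e)>F(g(A),h(A))$ implies that $A$ is nonsingular. For $\alpha,\beta\in[0,1]$,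 with the convention $0^0=1$, define functions $\mathbb R_+^n\times\mathbb R_+^n\to\mathbb R_+^{n(n-1)}$ by the following components, indexed by the ordered pairs $i,j\in\mathcal N$ with $i\ne j$: - $F_{1,\alpha}$: $x_i^\alpha y_j^{1-\alpha}$; - $F_{2,\alpha}$: $(x_ix_j)^\alpha(y_iy_j)^{1-\alpha}$; - $F_{3,\alpha}$: $(x_iy_j)^\alpha(x_jy_i)^{1-\alpha}$; - $F_{4,\alpha}$: $\alpha x_ix_j+(1-\alpha)y_iy_j$; - $F_{5,\alpha}$: $\alpha x_iy_j+(1-\alpha)x_jy_i$; - $F_{6,\alpha}$: $(\alpha x_i+(1-\alpha)y_i)(\alpha x_j+(1-\alpha)y_j)$; - $F_{7,\alpha}$: $(\alpha x_i+(1-\alpha)y_i)(\alpha y_j+(1-\alpha)x_j)$; - $F_{8,\alpha,\beta}$: $(x_i^\beta y_i^{1-\beta})^\alpha(x_j^\beta y_j^{1-\beta})^{1-\alpha}$; - $F_{9,\alpha,\beta}$: $(x_i^\beta y_i^{1-\beta})^\alpha(y_j^\beta x_j^{1-\beta})^{1-\alpha}$; - $F_{10,\alpha,\beta}$: $\beta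 x_i^\alpha x_j^{1-\alpha}+(1-\beta)y_i^\alpha y_j^{1-\alpha}$; - $F_{11,\alpha,\beta}$: $\beta x_i^\alpha y_j^{1-\alpha}+(1-\beta)y_i^\alpha x_j^{1-\alpha}$; - $F_{12,\alpha,\beta}$: $(\beta x_i+(1-\beta)y_i)^\alpha(\beta x_j+(1-\beta)y_j)^{1-\alpha}$; - $F_{13,\alpha,\beta}$: $(\beta x_i+(1-\beta)y_i)^\alpha(\beta y_j+(1-\beta)x_j)^{1-\alpha}$. Write $\mathcal G^F_{\mu,\alpha}$ ($\mu=1,\dots,7$) and $\mathcal G^F_{\nu,\alpha,\beta}$ ($\nu=8,\dots,13$) for the induced sets of $G$-function pairs. Let $r_i(A)=\sum_{j\ne i}|a_{i,j}|$ and $c_i(A)=\sum_{j\ne i}|a_{j,i}|$. Let $\tilde r_i(A)$ and $\tilde c_i(A)$ be the same sums restricted to those $j\neq i$ that lie in the same diagonal block of the Frobenius normal form of $A$ as $i$, that is, in the same strongly connected component of the directed graph of $A$ (with an arc $k\to l$ if $a_{k,l}\ne0$). For $f\in\{r,c,\tilde r,\tilde c\}$ and a diagonal matrix $X$ with positive diagonal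 entries let $f^X(A)=f(X^{-1}AX)$. Let $r_\delta(A)=\max_k r_k(A)$, and for $s\in\mathbb R$ let $r^{(s)}=(1+r_\delta)^s\,r$. **Theorem.** Let $\alpha,\beta\in[0,1]$. (A) All thirteen functions are monotonic, and $\mathcal G_n\times\mathcal G_n$ is a proper subset of each of $\mathcal G^F_{\mu,\alpha}$, $\mu=1,\dots,7$, and $\mathcal G^F_{\nu,\alpha,\beta}$, $\nu=8,\dots,13$. (B) The following pairs belong to the indicated sets, but not to $\mathcal G_n\times\mathcal G_n$. 1. If $0<\alpha<1$: $(r^{(-1/\alpha)},r^{(1/(1-\alpha))})\in\mathcal G^F_{\mu,\alpha}$ for $\mu=1,2,4,6$. 2. If $0<\beta<1$: $(r^{(-1/\beta)},r^{(1/(1-\beta))})\in\mathcal G^F_{\nu,\alpha,\beta}$ for $\nu=8,10,12$. 3. $\mathcal F_n\setminus\mathcal G_n\neq\emptyset$, and for all $g\in\mathcal G_n$ and $h_0\in\mathcal F_n\setminus\mathcal G_n$: $(g,h_0)\in\mathcal G^F_{\mu,1}$ and $(h_0,g)\in\mathcal G^F_{\mu,0}$ for $\mu=1,2,4,6$; $(g,h_0)\in\mathcal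 G^F_{\nu,\alpha,1}$ and $(h_0,g)\in\mathcal G^F_{\nu,\alpha,0}$ for $\nu=8,10,12$. 4. $(r^{(-1)},r^{(1)})\in\mathcal G^F_{\mu,\alpha}$ for $\mu=3,5,7$. 5. If $0<\beta<1$ and $\eta=\dfrac{\alpha+\beta-2\alpha\beta}{1-\alpha-\beta+2\alpha\beta}$: $(r^{(-\eta)},r^{(1)})\in\mathcal G^F_{\nu,\alpha,\beta}$ for $\nu=9,11,13$. 6. For $\nu=9,11,13$ and $\beta=0$: if $0<\alpha<1$ then $(r^{(1/(1-\alpha))},r^{(-1/\alpha)})\in\mathcal G^F_{\nu,\alpha,0}$; and for all $g\in\mathcal G_n$ and $h_0\in\mathcal F_n\setminus\mathcal G_n$, $(h_0,g)\in\mathcal G^F_{\nu,1,0}$ and $(g,h_0)\in\mathcal G^F_{\nu,0,0}$. Moreover, for $\nu=9,11,13$, $\mathcal G^F_{\nu,\alpha,1}=\mathcal G^F_{1,\alpha}$ (so the pairs of items 1 and 3 for $\mu=1$ serve for $\beta=1$), and $\mathcal G^F_{\nu,\alpha,0}$ is the set of $G$-function pairs induced by $(x,y)\mapsto F_{1,\alpha}(y,x)$.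 (C) For all diagonal matrices $X,Y$ with positive diagonal entries and all $g,h\in\{r,\tilde r,c,\tilde c,r^X,r^Y,c^X,c^Y,\tilde r^X,\tilde r^Y,\tilde c^X,\tilde c^Y\}$, the pair $(g,h)$ belongs to $\mathcal G^F_{\mu,\alpha}$ for $\mu=1,\dots,7$ and to $\mathcal G^F_{\nu,\alpha,\beta}$ for $\nu=8,\dots,13$. -/

import Mathlib

namespace GPairs

/-- Column vectors of length `n` with real entries, with the componentwise order `≤`. The paper's
`ℝ₊ⁿ` is the set of those `x` with `0 ≤ x`. -/
abbrev Vec (n : ℕ) : Type := Fin n → ℝ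

/-- Complex `n × n` matrices. -/
abbrev CMat (n : ℕ) : Type := Matrix (Fin n) (Fin n) ℂ

/-- Ordered pairs `(i, j)` of distinct indices; there are `n (n - 1)` of them. -/
abbrev OffDiag (n : ℕ) : Type := {p : Fin n × Fin n // p.1 ≠ p.2}

/-- Vector valued functions `f = [f₁, …, fₙ]ᵀ` of a complex matrix. -/
abbrev MatFun (n : ℕ) : Type := CMat n → Vec n

/-- Functions of two vectors, with values indexed by the ordered pairs `i ≠ j`. They only matter on
nonnegative vectors. -/
abbrev PairFun (n : ℕ) : Type := Vec n → Vec n → (OffDiag n → ℝ)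

/-- `|D(A)| e`, the vector of the moduli of the diagonal entries. -/
noncomputable def absDiag {n : ℕ} (A : CMat n) : Vec n := fun i => ‖A i i‖

/-- `𝓕ₙ`: functions with values in `ℝ₊ⁿ` all of whose components depend only on the moduli of the
off-diagonal entries of the matrix. -/
def FFun (n : ℕ) : Set (MatFun n) :=
  {f | (∀ A k, 0 ≤ f A k) ∧
    ∀ A B : CMat n, (∀ i j, i ≠ j → ‖A i j‖ = ‖B i j‖) → ∀ k, f A k = f B k}

/-- `𝓖ₙ`: the `G`-functions. -/
def GFun (n : ℕ) : Set (MatFun n) :=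
  {f | f ∈ FFun n ∧ ∀ A : CMat n, (∀ i, f A i < absDiag A i) → A.det ≠ 0}

/-- `F` maps `ℝ₊ⁿ × ℝ₊ⁿ` to nonnegative vectors and is monotonic there. -/
def IsMonotonic {n : ℕ} {ι : Type*} (F : Vec n → Vec n → (ι → ℝ)) : Prop :=
  (∀ x y, 0 ≤ x → 0 ≤ y → 0 ≤ F x y) ∧
    ∀ x y u v, 0 ≤ u → 0 ≤ v → u ≤ x → v ≤ y → F u v ≤ F x y

/-- `𝓖^F`: the `G`-function pairs induced by `F`. -/
def GPairSet {n : ℕ} {ι : Type*} (F : Vec n → Vec n → (ι → ℝ)) : Set (MatFun n × MatFun n) :=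
  {p | p.1 ∈ FFun n ∧ p.2 ∈ FFun n ∧
    ∀ A : CMat n, (∀ s, F (p.1 A) (p.2 A) s < F (absDiag A) (absDiag A) s) → A.det ≠ 0}

/-! The thirteen functions. `Real.rpow` follows the convention `0 ^ 0 = 1` and `0 ^ α = 0` for
`α > 0`. -/

noncomputable def F1 {n : ℕ} (α : ℝ) : PairFun n := fun x y ⟨(i, j), _⟩ =>
  x i ^ α * y j ^ (1 - α)

noncomputable def F2 {n : ℕ} (α : ℝ) : PairFun n := fun x y ⟨(i, j), _⟩ =>
  (x i * x j) ^ α * (y i * y j) ^ (1 - α)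

noncomputable def F3 {n : ℕ} (α : ℝ) : PairFun n := fun x y ⟨(i, j), _⟩ =>
  (x i * y j) ^ α * (x j * y i) ^ (1 - α)

noncomputable def F4 {n : ℕ} (α : ℝ) : PairFun n := fun x y ⟨(i, j), _⟩ =>
  α * (x i * x j) + (1 - α) * (y i * y j)

noncomputable def F5 {n : ℕ} (α : ℝ) : PairFun n := fun x y ⟨(i, j), _⟩ =>
  α * (x i * y j) + (1 - α) * (x j * y i)

noncomputable def F6 {n : ℕ} (α : ℝ) : PairFun n := fun x y ⟨(i, j), _⟩ =>
  (α * x i + (1 - α) * y i) * (α * x j + (1 - α) * y j)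

noncomputable def F7 {n : ℕ} (α : ℝ) : PairFun n := fun x y ⟨(i, j), _⟩ =>
  (α * x i + (1 - α) * y i) * (α * y j + (1 - α) * x j)

noncomputable def F8 {n : ℕ} (α β : ℝ) : PairFun n := fun x y ⟨(i, j), _⟩ =>
  (x i ^ β * y i ^ (1 - β)) ^ α * (x j ^ β * y j ^ (1 - β)) ^ (1 - α)

noncomputable def F9 {n : ℕ} (α β : ℝ) : PairFun n := fun x y ⟨(i, j), _⟩ =>
  (x i ^ β * y i ^ (1 - β)) ^ α * (y j ^ β * x j ^ (1 - β)) ^ (1 - α)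

noncomputable def F10 {n : ℕ} (α β : ℝ) : PairFun n := fun x y ⟨(i, j), _⟩ =>
  β * (x i ^ α * x j ^ (1 - α)) + (1 - β) * (y i ^ α * y j ^ (1 - α))

noncomputable def F11 {n : ℕ} (α β : ℝ) : PairFun n := fun x y ⟨(i, j), _⟩ =>
  β * (x i ^ α * y j ^ (1 - α)) + (1 - β) * (y i ^ α * x j ^ (1 - α))

noncomputable def F12 {n : ℕ} (α β : ℝ) : PairFun n := fun x y ⟨(i, j), _⟩ =>
  (β * x i + (1 - β) * y i) ^ α * (β * x j + (1 - β) * y j) ^ (1 - α)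

noncomputable def F13 {n : ℕ} (α β : ℝ) : PairFun n := fun x y ⟨(i, j), _⟩ =>
  (β * x i + (1 - β) * y i) ^ α * (β * y j + (1 - β) * x j) ^ (1 - α)

/-- The collection of all thirteen functions for given `α` and `β`. -/
def thirteen (n : ℕ) (α β : ℝ) : Set (PairFun n) :=
  {F1 α, F2 α, F3 α, F4 α, F5 α, F6 α, F7 α,
    F8 α β, F9 α β, F10 α β, F11 α β, F12 α β, F13 α β}

/-- `r`: deleted absolute row sums. -/
noncomputable def rowSum {n : ℕ} : MatFun n := fun A i =>
  ∑ j ∈ Finset.univ.erase i, ‖A i j‖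

/-- `c`: deleted absolute column sums. -/
noncomputable def colSum {n : ℕ} : MatFun n := fun A i =>
  ∑ j ∈ Finset.univ.erase i, ‖A j i‖

/-- Two indices lie in the same diagonal block of the Frobenius normal form of `A`, that is, in the
same strongly connected component of the directed graph of `A` (see `sameBlock_iff`). -/
def SameBlock {n : ℕ} (A : CMat n) (i j : Fin n) : Prop :=
  Relation.ReflTransGen (fun k l => A k l ≠ 0) i j ∧
    Relation.ReflTransGen (fun k l => A k l ≠ 0) j i

/-- `SameBlock` agrees with every Frobenius normal form: if the blocks are labelled by `b`, the
matrix is block upper triangular, and each diagonal block is irreducible (or of order one), then two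
indices are in the same block exactly when their labels agree. -/
theorem sameBlock_iff {n : ℕ} (A : CMat n) (b : Fin n → ℕ)
    (htri : ∀ i j, b j < b i → A i j = 0)
    (hirr : ∀ (k : ℕ) (S : Set (Fin n)), S.Nonempty → S ⊂ {i | b i = k} →
      ∃ i ∈ S, ∃ j, b j = k ∧ j ∉ S ∧ A i j ≠ 0) (i j : Fin n) :
    SameBlock A i j ↔ b i = b j := by
  have mono : ∀ i j, Relation.ReflTransGen (fun k l => A k l ≠ 0) i j → b i ≤ b j := by
    intro i j h
    induction h with
    | refl => exact le_rfl
    | tail _ hs ih => exact ih.trans (not_lt.1 fun hlt => hs (htri _ _ hlt))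
  have key : ∀ i j, b i = b j → Relation.ReflTransGen (fun k l => A k l ≠ 0) i j := by
    intro i j hij
    by_contra hne
    obtain ⟨s, hs, t, ht, hts, hst⟩ := hirr (b i)
      {l | b l = b i ∧ Relation.ReflTransGen (fun k l => A k l ≠ 0) i l}
      ⟨i, rfl, .refl⟩ ⟨fun l hl => hl.1, fun hsub => hne (hsub (show b j = b i from hij.symm)).2⟩
    exact hts ⟨ht, hs.2.tail hst⟩
  exact ⟨fun h => le_antisymm (mono _ _ h.1) (mono _ _ h.2),
    fun h => ⟨key _ _ h, key _ _ h.symm⟩⟩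

open Classical in
/-- `r̃`: deleted absolute row sums taken inside the diagonal blocks of the Frobenius normal form. -/
noncomputable def blockRowSum {n : ℕ} : MatFun n := fun A i =>
  ∑ j ∈ Finset.univ.filter (fun j => j ≠ i ∧ SameBlock A i j), ‖A i j‖

open Classical in
/-- `c̃`: deleted absolute column sums taken inside the diagonal blocks of the Frobenius normal
form. -/
noncomputable def blockColSum {n : ℕ} : MatFun n := fun A i =>
  ∑ j ∈ Finset.univ.filter (fun j => j ≠ i ∧ SameBlock A i j), ‖A j i‖

/-- `f^X (A) = f (X⁻¹ A X)` for the diagonal matrix `X` with diagonal entries `x₁, …, xₙ`, which are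
positive wherever this is used. -/
noncomputable def weighted {n : ℕ} (x : Vec n) (f : MatFun n) : MatFun n := fun A =>
  f (Matrix.diagonal (fun i => ((x i : ℂ))⁻¹) * A * Matrix.diagonal (fun i => (x i : ℂ)))

/-- The functions `r, r̃, c, c̃` and their versions weighted by `X` and by `Y`. -/
def sumFunctions {n : ℕ} (x y : Vec n) : Set (MatFun n) :=
  {rowSum, blockRowSum, colSum, blockColSum,
    weighted x rowSum, weighted y rowSum, weighted x colSum, weighted y colSum,
    weighted x blockRowSum, weighted y blockRowSum,
    weighted x blockColSum, weighted y blockColSum}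

/-- `r_δ(A)`, the largest deleted absolute row sum. -/
noncomputable def maxRowSum {n : ℕ} (A : CMat n) : ℝ := ⨆ k, rowSum A k

/-- The function `(1 + r_δ) ^ s • r`. -/
noncomputable def scaledRowSum {n : ℕ} (s : ℝ) : MatFun n := fun A k =>
  (1 + maxRowSum A) ^ s * rowSum A k

/-- The exponent `η = (α + β - 2αβ) / (1 - α - β + 2αβ)`; its numerator and denominator are positive
when `0 ≤ α ≤ 1` and `0 < β < 1`. -/
noncomputable def eta (α β : ℝ) : ℝ :=
  (α + β - 2 * α * β) / (1 - α - β + 2 * α * β)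

end GPairs

namespace GPairs

open Finset

/-! ### Diagonal dominance -/

/-! All thirteen functions are treated alike, through one number: a weight γ with m = x^γ y^(1-γ)
componentwise (`Controlled`). Multiplying the components of F at (i, j) and (j, i) gives at least
(m_i m_j)^p, with equality when x = y. Hence F(|D|e, |D|e) > F(g, h) yields |a_ii| |a_jj| > m_i m_j
for all i ≠ j, where m = g^γ h^(1-γ), and (g, h) is a pair as soon as m is a G-function
(`Controlled.mem_GPairSet`).

Two facts about G-functions carry this. They satisfy Brauer's oval condition
(`det_ne_zero_of_mem_GFun_of_mul_lt`), and they are closed under weighted geometric means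
(`geomMean_mem_GFun`). Both rest on `exists_weights_of_mem_GFun`: up to ε, a G-function bounds
weighted row sums for suitable positive weights, by an M-matrix argument.

The weight is α for F1, F2, F4, F6; 1/2 for F3, F5, F7; β for F8, F10, F12; and αβ + (1-α)(1-β) for
F9, F11, F13. The sums lie above geometric counterparts by AM-GM. Properness holds because only the
geometric mean has to be a G-function: a factor making g too small may be compensated in h, and at γ
= 0 or 1 one component is ignored altogether. -/

theorem det_ne_zero_of_weighted_row {n : ℕ} {A : CMat n} {x : Vec n} (hx : ∀ i, 0 < x i)
    (h : ∀ i, ∑ j ∈ univ.erase i, ‖A i j‖ * x j < ‖A i i‖ * x i) : A.det ≠ 0 := by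
  have h1 : (A * Matrix.diagonal (fun i => (x i : ℂ))).det ≠ 0 := by
    apply det_ne_zero_of_sum_row_lt_diag
    intro i
    simpa [Matrix.mul_diagonal, abs_of_pos (hx _)] using h i
  rw [Matrix.det_mul] at h1
  exact left_ne_zero_of_mul h1

/-- Gershgorin-type estimate for a vector in the kernel. -/
theorem norm_diag_mul_le {n : ℕ} {A : CMat n} {v : Fin n → ℂ} (hv : A.mulVec v = 0) (i : Fin n) :
    ‖A i i‖ * ‖v i‖ ≤ ∑ j ∈ univ.erase i, ‖A i j‖ * ‖v j‖ := by
  have h := congrFun hv i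
  simp only [Matrix.mulVec, dotProduct, Pi.zero_apply] at h
  rw [← Finset.add_sum_erase _ _ (mem_univ i)] at h
  rw [← norm_mul, eq_neg_of_add_eq_zero_left h, norm_neg]
  exact (norm_sum_le _ _).trans (le_of_eq (sum_congr rfl fun j _ => norm_mul _ _))

/-- Brauer's theorem on ovals of Cassini, for weighted row sums. -/
theorem det_ne_zero_of_brauer {n : ℕ} (hn : 2 ≤ n) {A : CMat n} {x t : Vec n}
    (hx : ∀ i, 0 < x i) (ht : ∀ i, 0 ≤ t i)
    (hsum : ∀ i, ∑ j ∈ univ.erase i, ‖A i j‖ * x j ≤ t i * x i)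
    (h : ∀ i j, i ≠ j → t i * t j < ‖A i i‖ * ‖A j j‖) : A.det ≠ 0 := by
  intro hdet
  obtain ⟨v, hv0, hv⟩ := Matrix.exists_mulVec_eq_zero_iff.2 hdet
  have : Nontrivial (Fin n) := Fin.nontrivial_iff_two_le.2 hn
  -- The kernel vector is measured relative to the weights. Brauer's argument then compares its
  -- largest entry w i with its second largest w j.
  set w : Vec n := fun i => ‖v i‖ / x i with hw
  have hvw : ∀ i, ‖v i‖ = w i * x i := fun i => by simp [hw, (hx i).ne']
  have hw0 : ∀ i, 0 ≤ w i := fun i => div_nonneg (norm_nonneg _) (hx i).le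
  have bound : ∀ i (m : ℝ), (∀ j, j ≠ i → w j ≤ m) → 0 ≤ m → ‖A i i‖ * w i ≤ t i * m := by
    intro i m hm hm0
    have h1 := norm_diag_mul_le hv i
    have h2 : ∑ j ∈ univ.erase i, ‖A i j‖ * ‖v j‖ ≤ (∑ j ∈ univ.erase i, ‖A i j‖ * x j) * m := by
      rw [sum_mul]
      refine sum_le_sum fun j hj => ?_
      rw [hvw j, mul_assoc, mul_comm (x j)]
      exact mul_le_mul_of_nonneg_left
        (mul_le_mul_of_nonneg_right (hm j (ne_of_mem_erase hj)) (hx j).le) (norm_nonneg _)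
    have h3 := mul_le_mul_of_nonneg_right (hsum i) hm0
    rw [hvw i] at h1
    have h4 : (‖A i i‖ * w i) * x i ≤ (t i * m) * x i := by linarith
    exact le_of_mul_le_mul_right h4 (hx i)
  obtain ⟨i, -, hi⟩ := exists_max_image univ w univ_nonempty
  obtain ⟨k, hk⟩ := exists_ne i
  obtain ⟨j, hj, hjmax⟩ := exists_max_image (univ.erase i) w ⟨k, by simp [hk]⟩
  have hji : j ≠ i := ne_of_mem_erase hj
  have hwi : 0 < w i := by
    rcases (hw0 i).lt_or_eq with h0 | h0
    · exact h0
    · exact absurd (funext fun l => by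
        have : w l ≤ 0 := h0 ▸ hi l (mem_univ l)
        have hl : w l = 0 := le_antisymm this (hw0 l)
        have := hvw l
        rw [hl, zero_mul, norm_eq_zero] at this
        exact this) hv0
  have b1 := bound i (w j) (fun l hl => hjmax l (by simp [hl])) (hw0 j)
  have b2 := bound j (w i) (fun l _ => hi l (mem_univ l)) hwi.le
  -- If w j > 0, the product of the two row estimates contradicts `hlt`. If w j = 0, row i forces A
  -- i i = 0, which `hlt` also excludes.
  have hlt := h i j hji.symm
  rcases (hw0 j).lt_or_eq with h0 | h0
  · have h1 := mul_le_mul b1 b2 (mul_nonneg (norm_nonneg _) h0.le) (mul_nonneg (ht i) h0.le)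
    nlinarith [mul_lt_mul_of_pos_right hlt (mul_pos hwi h0)]
  · rw [← h0, mul_zero] at b1
    have hz : ‖A i i‖ = 0 := le_antisymm (by nlinarith [norm_nonneg (A i i)]) (norm_nonneg _)
    rw [hz, zero_mul] at hlt
    exact absurd hlt (not_lt.2 (mul_nonneg (ht i) (ht j)))

/-! ### Supersolutions for matrices with nonpositive off-diagonal entries -/

/-- If `diag(t + s) - B` is nonsingular for all `s ≥ 0`, then `diag t - B` has a positive
supersolution. -/
theorem exists_pos_supersolution {n : ℕ} (B : Matrix (Fin n) (Fin n) ℝ) (hB : ∀ i j, 0 ≤ B i j)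
    {t : Vec n} (ht : ∀ i, 0 < t i)
    (hdet : ∀ s : NNReal, (Matrix.diagonal (fun i => t i + s) - B).det ≠ 0) :
    ∃ x : Vec n, (∀ i, 0 < x i) ∧ ∀ i, ∑ j, B i j * x j ≤ t i * x i := by
  rcases isEmpty_or_nonempty (Fin n) with he | hne
  · exact ⟨0, fun i => he.elim i, fun i => he.elim i⟩
  set M : NNReal → Matrix (Fin n) (Fin n) ℝ := fun s => Matrix.diagonal (fun i => t i + s) - B
    with hM
  have hMc : Continuous M := by
    refine Continuous.sub (Continuous.matrix_diagonal ?_) continuous_const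
    fun_prop
  -- Continuity method: x s solves (diag(t + s) - B) x = 1, and positivity is carried from large s
  -- down to s = 0 by connectedness of [0, ∞).
  set x : NNReal → Vec n := fun s => ((M s).det)⁻¹ • ((M s).adjugate.mulVec 1) with hx
  have hxc : Continuous x :=
    (hMc.matrix_det.inv₀ hdet).smul (hMc.matrix_adjugate.matrix_mulVec continuous_const)
  have hsol : ∀ s i, (t i + s) * x s i = 1 + ∑ j, B i j * x s j := by
    intro s i
    have h1 : (M s).mulVec (x s) = 1 := by
      simp only [hx]
      rw [Matrix.mulVec_smul, Matrix.mulVec_mulVec, Matrix.mul_adjugate, Matrix.smul_mulVec,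
        Matrix.one_mulVec, smul_smul, inv_mul_cancel₀ (hdet s), one_smul]
    have h2 := congrFun h1 i
    simp only [hM, Matrix.sub_mulVec, Pi.sub_apply, Matrix.mulVec_diagonal, Pi.one_apply] at h2
    simp only [Matrix.mulVec, dotProduct] at h2
    linarith
  have hpos : ∀ s, (∀ i, 0 ≤ x s i) → ∀ i, 0 < x s i := by
    intro s hs i
    have h1 : 0 ≤ ∑ j, B i j * x s j := sum_nonneg fun j _ => mul_nonneg (hB i j) (hs j)
    have h2 := hsol s i
    have h3 : 0 < t i + s := add_pos_of_pos_of_nonneg (ht i) s.2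
    exact pos_of_mul_pos_right (by linarith : 0 < (t i + s) * x s i) h3.le
  -- Closedness is the point: a limit of positive solutions is nonnegative, and the constant term 1
  -- in `hsol` makes a nonnegative solution positive.
  have hclopen : IsClopen {s | ∀ i, 0 < x s i} := by
    constructor
    · have : {s | ∀ i, 0 < x s i} = {s | ∀ i, 0 ≤ x s i} :=
        Set.ext fun s => ⟨fun h i => (h i).le, hpos s⟩
      rw [this, Set.ofPred_forall]
      exact isClosed_iInter fun i =>
        isClosed_le continuous_const ((continuous_apply i).comp hxc)
    · rw [Set.ofPred_forall]
      exact isOpen_iInter_of_finite fun i =>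
        isOpen_lt continuous_const ((continuous_apply i).comp hxc)
  have hnonempty : {s | ∀ i, 0 < x s i}.Nonempty := by
    -- With s the sum of all entries of B, the matrix is strictly diagonally dominant, and the
    -- equation at the smallest coordinate shows that this coordinate is positive.
    refine ⟨⟨∑ i, ∑ j, B i j, sum_nonneg fun i _ => sum_nonneg fun j _ => hB i j⟩, ?_⟩
    set s : NNReal := ⟨∑ i, ∑ j, B i j, _⟩ with hs
    have hsv : (s : ℝ) = ∑ i, ∑ j, B i j := rfl
    obtain ⟨i, -, hi⟩ := exists_min_image univ (x s) univ_nonempty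
    have h1 : ∑ j, B i j * x s i ≤ ∑ j, B i j * x s j :=
      sum_le_sum fun j _ => mul_le_mul_of_nonneg_left (hi j (mem_univ j)) (hB i j)
    have h2 : ∑ j, B i j ≤ s := by
      rw [hsv]
      exact single_le_sum (f := fun i => ∑ j, B i j)
        (fun k _ => sum_nonneg fun j _ => hB k j) (mem_univ i)
    have h3 := hsol s i
    rw [← sum_mul] at h1
    have h4 : 0 < (t i + s - ∑ j, B i j) * x s i := by linarith
    have h5 : 0 < x s i := pos_of_mul_pos_right h4 (by linarith [ht i])
    exact fun k => h5.trans_le (hi k (mem_univ k))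
  have huniv := hclopen.eq_univ hnonempty
  have h0 : ∀ i, 0 < x 0 i := by
    have : (0 : NNReal) ∈ {s | ∀ i, 0 < x s i} := huniv ▸ Set.mem_univ _
    exact this
  refine ⟨x 0, h0, fun i => ?_⟩
  have h1 := hsol 0 i
  simp only [NNReal.coe_zero, add_zero] at h1
  linarith

/-- The value of f ignores the diagonal and the phases, so the G-property applies to the real matrix
with off-diagonal entries -|a_ij| and diagonal f(A) + ε + s. It is nonsingular for every s ≥ 0,
which is what `exists_pos_supersolution` requires; ε > 0 supplies the strict inequality. -/
theorem exists_weights_of_mem_GFun {n : ℕ} {f : MatFun n} (hf : f ∈ GFun n) (A : CMat n) {ε : ℝ}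
    (hε : 0 < ε) :
    ∃ x : Vec n, (∀ i, 0 < x i) ∧
      ∀ i, ∑ j ∈ univ.erase i, ‖A i j‖ * x j ≤ (f A i + ε) * x i := by
  have hnn := hf.1.1
  obtain ⟨x, hx, hsum⟩ := exists_pos_supersolution
    (Matrix.of fun i j => if i = j then 0 else ‖A i j‖) (t := fun i => f A i + ε)
    (fun i j => by simp only [Matrix.of_apply]; split_ifs <;> positivity)
    (fun i => add_pos_of_nonneg_of_pos (hnn A i) hε) (by
      intro s hdet
      set R : Matrix (Fin n) (Fin n) ℝ := Matrix.diagonal (fun i => f A i + ε + s) -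
        Matrix.of fun i j => if i = j then 0 else ‖A i j‖ with hR
      set C : CMat n := R.map Complex.ofRealHom with hC
      have hCA : ∀ k, f C k = f A k := hf.1.2 C A fun i j hij => by
        simp [hC, hR, hij]
      refine hf.2 C (fun i => ?_) ?_
      · have h1 : C i i = ((f A i + ε + s : ℝ) : ℂ) := by simp [hC, hR]
        rw [hCA, absDiag, h1, Complex.norm_real, Real.norm_eq_abs]
        refine lt_of_lt_of_le ?_ (le_abs_self _)
        linarith [s.coe_nonneg]
      · rw [hC, ← RingHom.mapMatrix_apply, ← RingHom.map_det, hdet, map_zero])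
  refine ⟨x, hx, fun i => le_trans (le_of_eq ?_) (hsum i)⟩
  rw [← Finset.add_sum_erase _ _ (mem_univ i)]
  simp only [Matrix.of_apply, if_true, zero_mul, zero_add]
  exact sum_congr rfl fun j hj => by rw [if_neg (ne_of_mem_erase hj).symm]

/-- Finitely many strict inequalities survive a small perturbation. -/
theorem exists_pos_forall_lt {ι : Type*} [Finite ι] {u : ι → ℝ → ℝ} {b : ι → ℝ}
    (hu : ∀ i, ContinuousAt (u i) 0) (h : ∀ i, u i 0 < b i) :
    ∃ ε > 0, ∀ i, u i ε < b i := by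
  have h1 : ∀ᶠ ε in nhds (0 : ℝ), ∀ i, u i ε < b i :=
    Filter.eventually_all.2 fun i => (hu i).eventually_lt continuousAt_const (h i)
  obtain ⟨δ, hδ, hball⟩ := Metric.eventually_nhds_iff.1 h1
  exact ⟨δ / 2, half_pos hδ, hball (by rw [Real.dist_eq, sub_zero, abs_of_pos (half_pos hδ)]; linarith)⟩

/-- Brauer's theorem with f(A) + ε as weighted row sum bounds; the finitely many strict inequalities
leave room for ε. -/
theorem det_ne_zero_of_mem_GFun_of_mul_lt {n : ℕ} (hn : 2 ≤ n) {f : MatFun n} (hf : f ∈ GFun n)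
    {A : CMat n} (h : ∀ i j, i ≠ j → f A i * f A j < absDiag A i * absDiag A j) :
    A.det ≠ 0 := by
  obtain ⟨ε, hε, hlt⟩ := exists_pos_forall_lt (ι := OffDiag n)
    (u := fun p ε => (f A p.1.1 + ε) * (f A p.1.2 + ε))
    (b := fun p => absDiag A p.1.1 * absDiag A p.1.2)
    (fun p => by fun_prop) (fun p => by simpa using h _ _ p.2)
  obtain ⟨x, hx, hsum⟩ := exists_weights_of_mem_GFun hf A hε
  exact det_ne_zero_of_brauer hn hx (fun i => add_nonneg (hf.1.1 A i) hε.le) hsum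
    fun i j hij => hlt ⟨(i, j), hij⟩

/-! ### Weighted geometric means -/

/-- The componentwise weighted geometric mean `x ^ γ y ^ (1 - γ)`. -/
noncomputable def geomMean {n : ℕ} (γ : ℝ) (x y : Vec n) : Vec n :=
  fun i => x i ^ γ * y i ^ (1 - γ)

theorem geomMean_mem_FFun {n : ℕ} (γ : ℝ) {g h : MatFun n} (hg : g ∈ FFun n) (hh : h ∈ FFun n) :
    (fun A => geomMean γ (g A) (h A)) ∈ FFun n :=
  ⟨fun A k => mul_nonneg (Real.rpow_nonneg (hg.1 A k) _) (Real.rpow_nonneg (hh.1 A k) _),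
    fun A B hAB k => by simp only [geomMean, hg.2 A B hAB k, hh.2 A B hAB k]⟩

/-- If x and y are weights for g and h, then x^γ y^(1-γ) are weights for the geometric mean, by
Hölder's inequality in each row. -/
theorem geomMean_mem_GFun {n : ℕ} {γ : ℝ} (hγ : γ ∈ Set.Icc (0 : ℝ) 1) {g h : MatFun n}
    (hg : g ∈ GFun n) (hh : h ∈ GFun n) : (fun A => geomMean γ (g A) (h A)) ∈ GFun n := by
  obtain ⟨hγ0, hγ1⟩ := hγ
  have hγ1' : 0 ≤ 1 - γ := sub_nonneg.2 hγ1
  refine ⟨geomMean_mem_FFun γ hg.1 hh.1, fun A hA => ?_⟩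
  obtain ⟨ε, hε, hlt⟩ := exists_pos_forall_lt
    (u := fun i ε => (g A i + ε) ^ γ * (h A i + ε) ^ (1 - γ)) (b := absDiag A)
    (fun i => ContinuousAt.mul
      (ContinuousAt.rpow_const (by fun_prop) (Or.inr hγ0))
      (ContinuousAt.rpow_const (by fun_prop) (Or.inr hγ1')))
    (fun i => by simpa [geomMean] using hA i)
  obtain ⟨x, hx, hxs⟩ := exists_weights_of_mem_GFun hg A hε
  obtain ⟨y, hy, hys⟩ := exists_weights_of_mem_GFun hh A hε
  have hz : ∀ i, 0 < x i ^ γ * y i ^ (1 - γ) := fun i =>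
    mul_pos (Real.rpow_pos_of_pos (hx i) _) (Real.rpow_pos_of_pos (hy i) _)
  refine det_ne_zero_of_weighted_row hz fun i => ?_
  set P := (g A i + ε) * x i with hPdef
  set Q := (h A i + ε) * y i with hQdef
  have hgp : 0 < g A i + ε := add_pos_of_nonneg_of_pos (hg.1.1 A i) hε
  have hhp : 0 < h A i + ε := add_pos_of_nonneg_of_pos (hh.1.1 A i) hε
  have hP : 0 < P := mul_pos hgp (hx i)
  have hQ : 0 < Q := mul_pos hhp (hy i)
  have hPQ : 0 < P ^ γ * Q ^ (1 - γ) :=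
    mul_pos (Real.rpow_pos_of_pos hP _) (Real.rpow_pos_of_pos hQ _)
  -- Hölder in its normalised form: AM-GM is applied to x_j / P and y_j / Q, whose sums against row
  -- i are at most 1.
  have hterm : ∀ j, x j ^ γ * y j ^ (1 - γ) ≤
      (γ * (x j / P) + (1 - γ) * (y j / Q)) * (P ^ γ * Q ^ (1 - γ)) := by
    intro j
    have h1 := Real.geom_mean_le_arith_mean2_weighted hγ0 hγ1' (div_pos (hx j) hP).le
      (div_pos (hy j) hQ).le (by ring)
    rw [Real.div_rpow (hx j).le hP.le, Real.div_rpow (hy j).le hQ.le, div_mul_div_comm,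
      div_le_iff₀ hPQ] at h1
    exact h1
  have hsum : ∑ j ∈ univ.erase i, ‖A i j‖ * (x j ^ γ * y j ^ (1 - γ)) ≤
      P ^ γ * Q ^ (1 - γ) := by
    calc _ ≤ ∑ j ∈ univ.erase i, ‖A i j‖ *
          ((γ * (x j / P) + (1 - γ) * (y j / Q)) * (P ^ γ * Q ^ (1 - γ))) :=
          sum_le_sum fun j _ => mul_le_mul_of_nonneg_left (hterm j) (norm_nonneg _)
      _ = (γ * ((∑ j ∈ univ.erase i, ‖A i j‖ * x j) / P) +
            (1 - γ) * ((∑ j ∈ univ.erase i, ‖A i j‖ * y j) / Q)) * (P ^ γ * Q ^ (1 - γ)) := by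
          simp only [sum_div, mul_sum, sum_mul, ← sum_add_distrib]
          exact sum_congr rfl fun j _ => by ring
      _ ≤ (γ * 1 + (1 - γ) * 1) * (P ^ γ * Q ^ (1 - γ)) := by
          refine mul_le_mul_of_nonneg_right (add_le_add ?_ ?_) hPQ.le
          · exact mul_le_mul_of_nonneg_left ((div_le_one hP).2 (hxs i)) hγ0
          · exact mul_le_mul_of_nonneg_left ((div_le_one hQ).2 (hys i)) hγ1'
      _ = _ := by ring
  refine hsum.trans_lt ?_
  rw [hPdef, hQdef, Real.mul_rpow hgp.le (hx i).le, Real.mul_rpow hhp.le (hy i).le,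
    mul_mul_mul_comm]
  exact mul_lt_mul_of_pos_right (hlt i) (hz i)

/-! ### The row and column sums are `G`-functions -/

theorem rowSum_mem_FFun {n : ℕ} : (rowSum : MatFun n) ∈ FFun n :=
  ⟨fun _ _ => sum_nonneg fun _ _ => norm_nonneg _,
    fun _ _ hAB k => sum_congr rfl fun j hj => hAB k j (ne_of_mem_erase hj).symm⟩

theorem rowSum_mem_GFun {n : ℕ} : (rowSum : MatFun n) ∈ GFun n :=
  ⟨rowSum_mem_FFun, fun _ hA => det_ne_zero_of_sum_row_lt_diag hA⟩

/-- The property of being a `G`-function is preserved by transposing the argument. -/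
theorem transpose_mem_GFun {n : ℕ} {f : MatFun n} (hf : f ∈ GFun n) :
    (fun A => f A.transpose) ∈ GFun n :=
  ⟨⟨fun A k => hf.1.1 _ k, fun A B hAB k => hf.1.2 _ _ (fun i j hij => hAB j i hij.symm) k⟩,
    fun A hA => by
      rw [← Matrix.det_transpose]
      exact hf.2 A.transpose hA⟩

theorem colSum_mem_GFun {n : ℕ} : (colSum : MatFun n) ∈ GFun n := transpose_mem_GFun rowSum_mem_GFun

/-- The directed graph reachability only depends on which off-diagonal entries vanish. -/
theorem reflTransGen_of_norm_eq {n : ℕ} {A B : CMat n}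
    (h : ∀ i j, i ≠ j → ‖A i j‖ = ‖B i j‖) {i j : Fin n}
    (hr : Relation.ReflTransGen (fun k l => A k l ≠ 0) i j) :
    Relation.ReflTransGen (fun k l => B k l ≠ 0) i j := by
  induction hr with
  | refl => exact .refl
  | @tail b c _ hs ih =>
    by_cases hbc : b = c
    · exact hbc ▸ ih
    · refine ih.tail ?_
      rwa [← norm_ne_zero_iff, ← h b c hbc, norm_ne_zero_iff]

theorem sameBlock_congr {n : ℕ} {A B : CMat n} (h : ∀ i j, i ≠ j → ‖A i j‖ = ‖B i j‖)
    (i j : Fin n) : SameBlock A i j ↔ SameBlock B i j := by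
  have h' : ∀ i j, i ≠ j → ‖B i j‖ = ‖A i j‖ := fun i j hij => (h i j hij).symm
  exact ⟨fun H => ⟨reflTransGen_of_norm_eq h H.1, reflTransGen_of_norm_eq h H.2⟩,
    fun H => ⟨reflTransGen_of_norm_eq h' H.1, reflTransGen_of_norm_eq h' H.2⟩⟩

theorem sameBlock_transpose {n : ℕ} (A : CMat n) (i j : Fin n) :
    SameBlock A.transpose i j ↔ SameBlock A i j := by
  have key : ∀ i j, Relation.ReflTransGen (fun k l => A.transpose k l ≠ 0) i j ↔
      Relation.ReflTransGen (fun k l => A k l ≠ 0) j i := fun i j =>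
    Relation.reflTransGen_swap (r := fun k l => A k l ≠ 0)
  rw [SameBlock, SameBlock, key, key, and_comm]

/-- A kernel vector is restricted to a strongly connected class meeting its support and reaching as
few indices as possible. Arcs leaving that class only meet zeros of the vector, so the usual maximum
argument inside the class involves only the block row sum. -/
theorem blockRowSum_mem_GFun {n : ℕ} : (blockRowSum : MatFun n) ∈ GFun n := by
  classical
  refine ⟨⟨fun _ _ => sum_nonneg fun _ _ => norm_nonneg _, fun A B hAB k => ?_⟩, ?_⟩
  · simp only [blockRowSum, sameBlock_congr hAB]
    exact sum_congr rfl fun j hj => hAB k j (by simp at hj; exact fun h => hj.1 h.symm)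
  intro A hA hdet
  obtain ⟨v, hv0, hv⟩ := Matrix.exists_mulVec_eq_zero_iff.2 hdet
  set reach : Fin n → Fin n → Prop := Relation.ReflTransGen (fun k l => A k l ≠ 0) with hreach
  obtain ⟨i₀, hi₀⟩ := Function.ne_iff.1 hv0
  obtain ⟨i, hi, hmin⟩ := exists_min_image (univ.filter fun i => v i ≠ 0)
    (fun i => (univ.filter fun j => reach i j).card) ⟨i₀, by simpa using hi₀⟩
  have hvi : v i ≠ 0 := by simpa using hi
  have back : ∀ j, reach i j → v j ≠ 0 → reach j i := by
    intro j hij hj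
    have hsub : (univ.filter fun l => reach j l) ⊆ univ.filter fun l => reach i l := by
      intro l hl
      simp only [mem_filter, mem_univ, true_and] at hl ⊢
      exact hij.trans hl
    have heq := eq_of_subset_of_card_le hsub (hmin j (by simpa using hj))
    -- Minimality turns the inclusion of reachable sets into equality, so j reaches everything i
    -- reaches, including i itself.
    have : i ∈ univ.filter fun l => reach j l := by
      rw [heq]; simpa using Relation.ReflTransGen.refl
    simpa using this
  obtain ⟨k, hk, hmax⟩ := exists_max_image (univ.filter fun j => SameBlock A i j)
    (fun j => ‖v j‖) ⟨i, by simpa using ⟨.refl, .refl⟩⟩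
  have hik : SameBlock A i k := by simpa using hk
  have hvk : 0 < ‖v k‖ :=
    (norm_pos_iff.2 hvi).trans_le (hmax i (by simpa using ⟨.refl, .refl⟩))
  have h1 := norm_diag_mul_le hv k
  have h2 : ∑ j ∈ univ.erase k, ‖A k j‖ * ‖v j‖ ≤ blockRowSum A k * ‖v k‖ := by
    rw [blockRowSum, sum_mul]
    refine le_trans (le_of_eq ?_) (sum_le_sum (f := fun j => ‖A k j‖ * ‖v j‖) fun j hj => ?_)
    · symm
      refine sum_subset (fun j hj => by simp at hj; simp [hj.1]) fun j hj hj' => ?_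
      by_contra hne
      obtain ⟨ha, hb⟩ := mul_ne_zero_iff.1 hne
      have hkj : reach k j := .single (norm_ne_zero_iff.1 ha)
      have hjk : reach j k :=
        (back j (hik.1.trans hkj) (norm_ne_zero_iff.1 hb)).trans hik.1
      exact hj' (by simpa using ⟨ne_of_mem_erase hj, hkj, hjk⟩)
    · simp only [mem_filter, mem_univ, true_and] at hj
      refine mul_le_mul_of_nonneg_left (hmax j ?_) (norm_nonneg _)
      exact mem_filter.2 ⟨mem_univ j, hik.1.trans hj.2.1, hj.2.2.trans hik.2⟩
  have h3 := mul_lt_mul_of_pos_right (hA k) hvk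
  exact absurd (h1.trans h2) (not_le.2 h3)

theorem blockColSum_mem_GFun {n : ℕ} : (blockColSum : MatFun n) ∈ GFun n := by
  have h : (blockColSum : MatFun n) = fun A => blockRowSum A.transpose := by
    funext A i
    refine sum_congr (Finset.ext fun j => ?_) fun _ _ => rfl
    simp only [mem_filter, sameBlock_transpose]
  exact h ▸ transpose_mem_GFun blockRowSum_mem_GFun

theorem weighted_mem_GFun {n : ℕ} {x : Vec n} (hx : ∀ i, 0 < x i) {f : MatFun n}
    (hf : f ∈ GFun n) : weighted x f ∈ GFun n := by
  have hentry : ∀ (A : CMat n) i j, (Matrix.diagonal (fun i => ((x i : ℂ))⁻¹) * A *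
      Matrix.diagonal (fun i => (x i : ℂ))) i j = (x i : ℂ)⁻¹ * A i j * x j := fun A i j => by
    rw [Matrix.mul_diagonal, Matrix.diagonal_mul]
  have hxc : ∀ i, (x i : ℂ) ≠ 0 := fun i => by exact_mod_cast (hx i).ne'
  refine ⟨⟨fun A k => hf.1.1 _ k, fun A B hAB k => hf.1.2 _ _ (fun i j hij => ?_) k⟩,
    fun A hA => ?_⟩
  · rw [hentry, hentry, norm_mul, norm_mul, norm_mul, norm_mul, hAB i j hij]
  · have h := hf.2 _ (fun i => (hA i).trans_eq (by
      rw [absDiag, absDiag, hentry, mul_right_comm, inv_mul_cancel₀ (hxc i), one_mul]))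
    rw [Matrix.det_mul, Matrix.det_mul] at h
    exact right_ne_zero_of_mul (left_ne_zero_of_mul h)

theorem sumFunctions_subset_GFun {n : ℕ} {x y : Vec n} (hx : ∀ i, 0 < x i) (hy : ∀ i, 0 < y i) :
    sumFunctions x y ⊆ GFun n := by
  rintro f (rfl | rfl | rfl | rfl | rfl | rfl | rfl | rfl | rfl | rfl | rfl | rfl)
  · exact rowSum_mem_GFun
  · exact blockRowSum_mem_GFun
  · exact colSum_mem_GFun
  · exact blockColSum_mem_GFun
  · exact weighted_mem_GFun hx rowSum_mem_GFun
  · exact weighted_mem_GFun hy rowSum_mem_GFun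
  · exact weighted_mem_GFun hx colSum_mem_GFun
  · exact weighted_mem_GFun hy colSum_mem_GFun
  · exact weighted_mem_GFun hx blockRowSum_mem_GFun
  · exact weighted_mem_GFun hy blockRowSum_mem_GFun
  · exact weighted_mem_GFun hx blockColSum_mem_GFun
  · exact weighted_mem_GFun hy blockColSum_mem_GFun

/-! ### Scaled row sums -/

theorem maxRowSum_nonneg {n : ℕ} (A : CMat n) : 0 ≤ maxRowSum A :=
  Real.iSup_nonneg fun k => rowSum_mem_FFun.1 A k

theorem scaledRowSum_mem_FFun {n : ℕ} (s : ℝ) : (scaledRowSum s : MatFun n) ∈ FFun n := by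
  refine ⟨fun A k => mul_nonneg (Real.rpow_nonneg
    (add_nonneg zero_le_one (maxRowSum_nonneg A)) _) (rowSum_mem_FFun.1 A k), fun A B hAB k => ?_⟩
  have h : rowSum A = rowSum B := funext (rowSum_mem_FFun.2 A B hAB)
  simp only [scaledRowSum, maxRowSum, h]

/-- The counterexample is the all-ones matrix minus n times the identity: it kills the vector of
ones, and each diagonal modulus equals the row sum n - 1. The factor n^s < 1 makes the scaled row
sum strictly smaller. -/
theorem scaledRowSum_notMem_GFun {n : ℕ} (hn : 2 ≤ n) {s : ℝ} (hs : s < 0) :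
    (scaledRowSum s : MatFun n) ∉ GFun n := by
  intro h
  have : Nonempty (Fin n) := ⟨⟨0, by omega⟩⟩
  have hn' : (0 : ℝ) < (n : ℝ) - 1 := by
    have : (2 : ℝ) ≤ n := by exact_mod_cast hn
    linarith
  set A : CMat n := Matrix.of fun i j => if i = j then -(((n : ℝ) - 1 : ℝ) : ℂ) else 1 with hA
  have hoff : ∀ i, ∀ j ∈ univ.erase i, A i j = 1 := fun i j hj => by
    simp [hA, (ne_of_mem_erase hj).symm]
  have hcard : ∀ i : Fin n, ((univ.erase i).card : ℝ) = (n : ℝ) - 1 := fun i => by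
    rw [card_erase_of_mem (mem_univ i), card_univ, Fintype.card_fin,
      Nat.cast_sub (by omega), Nat.cast_one]
  have hrow : ∀ i, rowSum A i = (n : ℝ) - 1 := fun i => by
    rw [rowSum, sum_congr rfl fun j hj => by rw [hoff i j hj, norm_one], sum_const, nsmul_eq_mul,
      mul_one, hcard]
  have hmax : maxRowSum A = (n : ℝ) - 1 := by
    simp only [maxRowSum, hrow, ciSup_const]
  refine h.2 A (fun i => ?_) ?_
  · have h1 : absDiag A i = (n : ℝ) - 1 := by
      rw [absDiag, hA, Matrix.of_apply, if_pos rfl, norm_neg, Complex.norm_real,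
        Real.norm_of_nonneg hn'.le]
    rw [h1, scaledRowSum, hrow, hmax]
    exact mul_lt_of_lt_one_left hn' (Real.rpow_lt_one_of_one_lt_of_neg (by linarith) hs)
  · refine Matrix.exists_mulVec_eq_zero_iff.1 ⟨1, one_ne_zero, funext fun i => ?_⟩
    simp only [Matrix.mulVec, dotProduct, Pi.one_apply, mul_one, Pi.zero_apply]
    rw [← Finset.add_sum_erase _ _ (mem_univ i), sum_congr rfl (hoff i), sum_const, nsmul_eq_mul,
      mul_one]
    have := hcard i
    have h2 : ((univ.erase i).card : ℂ) = (((n : ℝ) - 1 : ℝ) : ℂ) := by rw [← this]; simp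
    rw [h2, hA, Matrix.of_apply, if_pos rfl, neg_add_cancel]

/-! ### Functions controlled by a weighted geometric mean -/

/-- `F` is monotonic and the products of its components at `(i, j)` and `(j, i)` dominate a power of
the corresponding products of the geometric mean of weight `γ`, with equality on the diagonal. -/
structure Controlled {n : ℕ} (F : PairFun n) (γ : ℝ) : Prop where
  mono : IsMonotonic F
  exists_power : ∃ p : ℕ, ∀ i j (hij : i ≠ j),
    (∀ x y : Vec n, 0 ≤ x → 0 ≤ y → (geomMean γ x y i * geomMean γ x y j) ^ p ≤
      F x y ⟨(i, j), hij⟩ * F x y ⟨(j, i), hij.symm⟩) ∧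
    ∀ x : Vec n, 0 ≤ x → F x x ⟨(i, j), hij⟩ * F x x ⟨(j, i), hij.symm⟩ = (x i * x j) ^ p

/-- Multiplying the strict inequalities at (i, j) and (j, i) and taking p-th roots gives Brauer's
condition for the geometric mean. Neither g nor h need be a G-function. -/
theorem Controlled.mem_GPairSet {n : ℕ} (hn : 2 ≤ n) {F : PairFun n} {γ : ℝ} (hF : Controlled F γ)
    {g h : MatFun n} (hg : g ∈ FFun n) (hh : h ∈ FFun n)
    (hgh : (fun A => geomMean γ (g A) (h A)) ∈ GFun n) : (g, h) ∈ GPairSet F := by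
  refine ⟨hg, hh, fun A hA => det_ne_zero_of_mem_GFun_of_mul_lt hn hgh fun i j hij => ?_⟩
  obtain ⟨p, hp⟩ := hF.exists_power
  obtain ⟨h1, h2⟩ := hp i j hij
  have hg0 : 0 ≤ g A := hg.1 A
  have hh0 : 0 ≤ h A := hh.1 A
  have hd0 : 0 ≤ absDiag A := fun i => norm_nonneg _
  have hF0 := hF.mono.1 _ _ hg0 hh0
  refine lt_of_pow_lt_pow_left₀ p (mul_nonneg (hd0 i) (hd0 j)) ?_
  rw [← h2 _ hd0]
  exact (h1 _ _ hg0 hh0).trans_lt (mul_lt_mul'' (hA _) (hA _) (hF0 _) (hF0 _))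

theorem Controlled.prod_subset {n : ℕ} (hn : 2 ≤ n) {F : PairFun n} {γ : ℝ}
    (hγ : γ ∈ Set.Icc (0 : ℝ) 1) (hF : Controlled F γ) : GFun n ×ˢ GFun n ⊆ GPairSet F :=
  fun _ hp => hF.mem_GPairSet hn hp.1.1 hp.2.1 (geomMean_mem_GFun hγ hp.1 hp.2)

/-- The hypothesis says that the powers of 1 + r_δ cancel in the mean. -/
theorem geomMean_scaledRowSum {n : ℕ} {γ s t : ℝ} (h : s * γ + t * (1 - γ) = 0) (A : CMat n) :
    geomMean γ (scaledRowSum s A) (scaledRowSum t A) = rowSum A := by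
  funext i
  have hm : 0 < 1 + maxRowSum A := add_pos_of_pos_of_nonneg one_pos (maxRowSum_nonneg A)
  have hr := rowSum_mem_FFun.1 A i
  rw [geomMean, scaledRowSum, scaledRowSum, Real.mul_rpow (Real.rpow_nonneg hm.le _) hr,
    Real.mul_rpow (Real.rpow_nonneg hm.le _) hr, mul_mul_mul_comm, ← Real.rpow_mul hm.le,
    ← Real.rpow_mul hm.le, ← Real.rpow_add hm, h, Real.rpow_zero, one_mul]
  rcases hr.lt_or_eq with h0 | h0
  · rw [← Real.rpow_add h0, add_sub_cancel, Real.rpow_one]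
  · rw [← h0]
    by_cases hγ : γ = 0
    · simp [hγ]
    · rw [Real.zero_rpow hγ, zero_mul]

theorem Controlled.scaledRowSum_mem {n : ℕ} (hn : 2 ≤ n) {F : PairFun n} {γ s t : ℝ}
    (hF : Controlled F γ) (h : s * γ + t * (1 - γ) = 0) (hst : s < 0 ∨ t < 0) :
    (scaledRowSum s, scaledRowSum t) ∈ GPairSet F \ GFun n ×ˢ GFun n := by
  refine ⟨hF.mem_GPairSet hn (scaledRowSum_mem_FFun s) (scaledRowSum_mem_FFun t) ?_, fun hp => ?_⟩
  · simpa only [geomMean_scaledRowSum h] using rowSum_mem_GFun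
  · exact hst.elim (fun hs => scaledRowSum_notMem_GFun hn hs hp.1)
      fun ht => scaledRowSum_notMem_GFun hn ht hp.2

/-- At weight 1 the second component enters with exponent 0, hence as the constant 1 by 0^0 = 1. The
weight is constrained by an equation so that weights given by formulas also qualify. -/
theorem Controlled.left_mem {n : ℕ} (hn : 2 ≤ n) {F : PairFun n} {γ : ℝ} (hF : Controlled F γ)
    (hγ : γ = 1) {g h₀ : MatFun n} (hg : g ∈ GFun n) (hh : h₀ ∈ FFun n \ GFun n) :
    (g, h₀) ∈ GPairSet F \ GFun n ×ˢ GFun n :=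
  ⟨hF.mem_GPairSet hn hg.1 hh.1 (by
    have : (fun A => geomMean γ (g A) (h₀ A)) = g := by
      funext A i
      simp [geomMean, hγ]
    rwa [this]), fun hp => hh.2 hp.2⟩

theorem Controlled.right_mem {n : ℕ} (hn : 2 ≤ n) {F : PairFun n} {γ : ℝ} (hF : Controlled F γ)
    (hγ : γ = 0) {g h₀ : MatFun n} (hg : g ∈ GFun n) (hh : h₀ ∈ FFun n \ GFun n) :
    (h₀, g) ∈ GPairSet F \ GFun n ×ˢ GFun n :=
  ⟨hF.mem_GPairSet hn hh.1 hg.1 (by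
    have : (fun A => geomMean γ (h₀ A) (g A)) = g := by
      funext A i
      simp [geomMean, hγ]
    rwa [this]), fun hp => hh.2 hp.1⟩

theorem FFun_diff_GFun_nonempty {n : ℕ} (hn : 2 ≤ n) : (FFun n \ GFun n).Nonempty :=
  ⟨scaledRowSum (-1), scaledRowSum_mem_FFun _, scaledRowSum_notMem_GFun hn (by norm_num)⟩

theorem Controlled.prod_ssubset {n : ℕ} (hn : 2 ≤ n) {F : PairFun n} {γ : ℝ}
    (hγ : γ ∈ Set.Icc (0 : ℝ) 1) (hF : Controlled F γ) : GFun n ×ˢ GFun n ⊂ GPairSet F := by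
  refine (Set.ssubset_iff_of_subset (hF.prod_subset hn hγ)).2 ?_
  obtain ⟨h₀, hh⟩ := FFun_diff_GFun_nonempty hn
  rcases hγ.1.eq_or_lt with h0 | h0
  · exact ⟨_, hF.right_mem hn h0.symm rowSum_mem_GFun hh⟩
  rcases hγ.2.eq_or_lt with h1 | h1
  · exact ⟨_, hF.left_mem hn h1 rowSum_mem_GFun hh⟩
  · have h1' : (1 : ℝ) - γ ≠ 0 := (sub_pos.2 h1).ne'
    exact ⟨_, hF.scaledRowSum_mem hn (s := -1 / γ) (t := 1 / (1 - γ)) (by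
      rw [div_mul_cancel₀ _ h0.ne', div_mul_cancel₀ _ h1']; norm_num)
      (Or.inl (div_neg_of_neg_of_pos (by norm_num) h0))⟩

/-! ### Scalar identities for real powers -/

theorem rpow_mul_rpow_one_sub {a : ℝ} (ha : 0 ≤ a) {α : ℝ} (hα : α ∈ Set.Icc (0 : ℝ) 1) :
    a ^ α * a ^ (1 - α) = a := by
  rw [← Real.rpow_add_of_nonneg ha hα.1 (sub_nonneg.2 hα.2), add_sub_cancel, Real.rpow_one]

theorem rpow_mul_le_mix {a b : ℝ} (ha : 0 ≤ a) (hb : 0 ≤ b) {α : ℝ}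
    (hα : α ∈ Set.Icc (0 : ℝ) 1) : a ^ α * b ^ (1 - α) ≤ α * a + (1 - α) * b :=
  Real.geom_mean_le_arith_mean2_weighted hα.1 (sub_nonneg.2 hα.2) ha hb (by ring)

theorem mix_self (α a : ℝ) : α * a + (1 - α) * a = a := by ring

theorem mix_nonneg {a b : ℝ} (ha : 0 ≤ a) (hb : 0 ≤ b) {α : ℝ} (hα : α ∈ Set.Icc (0 : ℝ) 1) :
    0 ≤ α * a + (1 - α) * b :=
  add_nonneg (mul_nonneg hα.1 ha) (mul_nonneg (sub_nonneg.2 hα.2) hb)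

theorem mix_le_mix {a b a' b' : ℝ} (ha : a ≤ a') (hb : b ≤ b') {α : ℝ}
    (hα : α ∈ Set.Icc (0 : ℝ) 1) : α * a + (1 - α) * b ≤ α * a' + (1 - α) * b' :=
  add_le_add (mul_le_mul_of_nonneg_left ha hα.1) (mul_le_mul_of_nonneg_left hb (sub_nonneg.2 hα.2))

/-- The weighted geometric mean of two numbers. -/
noncomputable def gm (α a b : ℝ) : ℝ := a ^ α * b ^ (1 - α)

theorem gm_nonneg {a b : ℝ} (ha : 0 ≤ a) (hb : 0 ≤ b) (α : ℝ) : 0 ≤ gm α a b :=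
  mul_nonneg (Real.rpow_nonneg ha _) (Real.rpow_nonneg hb _)

theorem gm_le_gm {a b a' b' : ℝ} (ha : 0 ≤ a) (hb : 0 ≤ b) (haa : a ≤ a') (hbb : b ≤ b') {α : ℝ}
    (hα : α ∈ Set.Icc (0 : ℝ) 1) : gm α a b ≤ gm α a' b' :=
  mul_le_mul (Real.rpow_le_rpow ha haa hα.1) (Real.rpow_le_rpow hb hbb (sub_nonneg.2 hα.2))
    (Real.rpow_nonneg hb _) (Real.rpow_nonneg (ha.trans haa) _)

/-- Passing from (i, j) to (j, i) swaps the arguments, so α drops out of the product. This is why α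
does not affect the weights of F3 and F8. -/
theorem gm_mul_swap {a b : ℝ} (ha : 0 ≤ a) (hb : 0 ≤ b) {α : ℝ} (hα : α ∈ Set.Icc (0 : ℝ) 1) :
    gm α a b * gm α b a = a * b := by
  conv_rhs => rw [← rpow_mul_rpow_one_sub ha hα, ← rpow_mul_rpow_one_sub hb hα]
  rw [gm, gm]; ring

theorem gm_mul_gm {a b c d : ℝ} (ha : 0 ≤ a) (hb : 0 ≤ b) (hc : 0 ≤ c) (hd : 0 ≤ d) (α : ℝ) :
    gm α a b * gm α c d = gm α (a * c) (b * d) := by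
  rw [gm, gm, gm, Real.mul_rpow ha hc, Real.mul_rpow hb hd]; ring

/-- The source of the weight 1/2 and the power p = 2 for F3. -/
theorem gm_half_sq {a b : ℝ} (ha : 0 ≤ a) (hb : 0 ≤ b) : gm (1 / 2) a b ^ 2 = a * b := by
  rw [gm, mul_pow, ← Real.sqrt_eq_rpow, show (1 : ℝ) - 1 / 2 = 1 / 2 by norm_num,
    ← Real.sqrt_eq_rpow, Real.sq_sqrt ha, Real.sq_sqrt hb]

/-- Nested geometric means. -/
theorem gm_gm_swap {a c : ℝ} (ha : 0 ≤ a) (hc : 0 ≤ c) {α β : ℝ} (hα : α ∈ Set.Icc (0 : ℝ) 1)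
    (hβ : β ∈ Set.Icc (0 : ℝ) 1) :
    gm α (gm β a c) (gm β c a) = gm (1 - α - β + 2 * α * β) a c := by
  have hα' := sub_nonneg.2 hα.2
  have hβ' := sub_nonneg.2 hβ.2
  have e1 : 1 - α - β + 2 * α * β = β * α + (1 - β) * (1 - α) := by ring
  have e2 : 1 - (1 - α - β + 2 * α * β) = (1 - β) * α + β * (1 - α) := by ring
  rw [gm, gm, gm, gm, e2, e1,
    Real.rpow_add_of_nonneg ha (mul_nonneg hβ.1 hα.1) (mul_nonneg hβ' hα'),
    Real.rpow_add_of_nonneg hc (mul_nonneg hβ' hα.1) (mul_nonneg hβ.1 hα'),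
    Real.mul_rpow (Real.rpow_nonneg ha _) (Real.rpow_nonneg hc _),
    Real.mul_rpow (Real.rpow_nonneg hc _) (Real.rpow_nonneg ha _),
    Real.rpow_mul ha, Real.rpow_mul ha, Real.rpow_mul hc, Real.rpow_mul hc]
  ring

/-- Geometric means of different weights commute. -/
theorem gm_gm_comm {a b c d : ℝ} (ha : 0 ≤ a) (hb : 0 ≤ b) (hc : 0 ≤ c) (hd : 0 ≤ d) {α β : ℝ} :
    gm α (gm β a b) (gm β c d) = gm β (gm α a c) (gm α b d) := by
  have key : ∀ {a : ℝ}, 0 ≤ a → ∀ s t : ℝ, (a ^ s) ^ t = (a ^ t) ^ s := fun ha s t => by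
    rw [← Real.rpow_mul ha, ← Real.rpow_mul ha, mul_comm]
  simp only [gm]
  rw [Real.mul_rpow (Real.rpow_nonneg ha _) (Real.rpow_nonneg hb _),
    Real.mul_rpow (Real.rpow_nonneg hc _) (Real.rpow_nonneg hd _),
    Real.mul_rpow (Real.rpow_nonneg ha _) (Real.rpow_nonneg hc _),
    Real.mul_rpow (Real.rpow_nonneg hb _) (Real.rpow_nonneg hd _),
    key ha β, key hb _ α, key hc β, key hd (1 - β)]
  ring

/-! ### The thirteen functions are controlled -/

/-- A larger monotonic function which agrees on the diagonal is controlled as well. -/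
theorem Controlled.of_le {n : ℕ} {F G : PairFun n} {γ : ℝ} (hF : Controlled F γ)
    (hG : ∀ x y u v : Vec n, 0 ≤ u → 0 ≤ v → u ≤ x → v ≤ y → ∀ i j (hij : i ≠ j),
      G u v ⟨(i, j), hij⟩ ≤ G x y ⟨(i, j), hij⟩)
    (hFG : ∀ x y : Vec n, 0 ≤ x → 0 ≤ y → ∀ i j (hij : i ≠ j),
      F x y ⟨(i, j), hij⟩ ≤ G x y ⟨(i, j), hij⟩)
    (hdiag : ∀ x : Vec n, 0 ≤ x → ∀ i j (hij : i ≠ j),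
      G x x ⟨(i, j), hij⟩ = F x x ⟨(i, j), hij⟩) : Controlled G γ := by
  refine ⟨⟨fun x y hx hy s => (hF.mono.1 x y hx hy s).trans (hFG x y hx hy _ _ s.2),
    fun x y u v hu hv hux hvy s => hG x y u v hu hv hux hvy _ _ s.2⟩, ?_⟩
  obtain ⟨p, hp⟩ := hF.exists_power
  refine ⟨p, fun i j hij => ⟨fun x y hx hy => ((hp i j hij).1 x y hx hy).trans ?_, fun x hx => ?_⟩⟩
  · have h0 := hF.mono.1 x y hx hy
    exact mul_le_mul (hFG x y hx hy i j hij) (hFG x y hx hy j i hij.symm) (h0 _)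
      ((h0 _).trans (hFG x y hx hy i j hij))
  · rw [hdiag x hx, hdiag x hx, (hp i j hij).2 x hx]

section

variable {n : ℕ} {α β : ℝ}

theorem controlled_F1 (hα : α ∈ Set.Icc (0 : ℝ) 1) : Controlled (F1 α : PairFun n) α := by
  refine ⟨⟨fun x y hx hy s => gm_nonneg (hx _) (hy _) α,
    fun x y u v hu hv hux hvy s => gm_le_gm (hu _) (hv _) (hux _) (hvy _) hα⟩,
    1, fun i j hij => ⟨fun x y hx hy => le_of_eq ?_, fun x hx => ?_⟩⟩
  · simp only [geomMean, F1, pow_one]; ring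
  · rw [pow_one]; exact gm_mul_swap (hx i) (hx j) hα

theorem controlled_F2 (hα : α ∈ Set.Icc (0 : ℝ) 1) : Controlled (F2 α : PairFun n) α := by
  have key : ∀ x y : Vec n, 0 ≤ x → 0 ≤ y → ∀ i j, geomMean α x y i * geomMean α x y j =
      (x i * x j) ^ α * (y i * y j) ^ (1 - α) := fun x y hx hy i j =>
    gm_mul_gm (hx i) (hy i) (hx j) (hy j) α
  refine ⟨⟨fun x y hx hy s => gm_nonneg (mul_nonneg (hx _) (hx _)) (mul_nonneg (hy _) (hy _)) α,
    fun x y u v hu hv hux hvy s => gm_le_gm (mul_nonneg (hu _) (hu _)) (mul_nonneg (hv _) (hv _))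
      (mul_le_mul (hux _) (hux _) (hu _) ((hu _).trans (hux _)))
      (mul_le_mul (hvy _) (hvy _) (hv _) ((hv _).trans (hvy _))) hα⟩,
    2, fun i j hij => ⟨fun x y hx hy => le_of_eq ?_, fun x hx => ?_⟩⟩
  · simp only [F2]
    rw [← key x y hx hy, ← key x y hx hy]; ring
  · simp only [F2]
    rw [rpow_mul_rpow_one_sub (mul_nonneg (hx i) (hx j)) hα,
      rpow_mul_rpow_one_sub (mul_nonneg (hx j) (hx i)) hα]; ring

theorem controlled_F3 (hα : α ∈ Set.Icc (0 : ℝ) 1) : Controlled (F3 α : PairFun n) (1 / 2) := by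
  have key : ∀ x y : Vec n, 0 ≤ x → 0 ≤ y → ∀ i j (hij : i ≠ j),
      (F3 α : PairFun n) x y ⟨(i, j), hij⟩ * F3 α x y ⟨(j, i), hij.symm⟩ =
        (x i * y i) * (x j * y j) := fun x y hx hy i j hij =>
    (gm_mul_swap (mul_nonneg (hx i) (hy j)) (mul_nonneg (hx j) (hy i)) hα).trans (by ring)
  refine ⟨⟨fun x y hx hy s => gm_nonneg (mul_nonneg (hx _) (hy _)) (mul_nonneg (hx _) (hy _)) α,
    fun x y u v hu hv hux hvy s => gm_le_gm (mul_nonneg (hu _) (hv _)) (mul_nonneg (hu _) (hv _))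
      (mul_le_mul (hux _) (hvy _) (hv _) ((hu _).trans (hux _)))
      (mul_le_mul (hux _) (hvy _) (hv _) ((hu _).trans (hux _))) hα⟩,
    2, fun i j hij => ⟨fun x y hx hy => le_of_eq ?_, fun x hx => ?_⟩⟩
  · rw [key x y hx hy, mul_pow]
    exact congrArg₂ _ (gm_half_sq (hx i) (hy i)) (gm_half_sq (hx j) (hy j))
  · rw [key x x hx hx]; ring

/-- F4 dominates F2 by weighted AM-GM and agrees with it on the diagonal. In the same way F6 lies
above F2; F5 and F7 above F3; F10 and F12 above F8; F11 and F13 above F9. -/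
theorem controlled_F4 (hα : α ∈ Set.Icc (0 : ℝ) 1) : Controlled (F4 α : PairFun n) α :=
  (controlled_F2 hα).of_le
    (fun _ _ _ _ hu hv hux hvy i j _ => mix_le_mix
      (mul_le_mul (hux i) (hux j) (hu j) ((hu i).trans (hux i)))
      (mul_le_mul (hvy i) (hvy j) (hv j) ((hv i).trans (hvy i))) hα)
    (fun _ _ hx hy i j _ =>
      rpow_mul_le_mix (mul_nonneg (hx i) (hx j)) (mul_nonneg (hy i) (hy j)) hα)
    (fun _ hx i j _ => (mix_self α _).trans
      (rpow_mul_rpow_one_sub (mul_nonneg (hx i) (hx j)) hα).symm)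

theorem controlled_F5 (hα : α ∈ Set.Icc (0 : ℝ) 1) : Controlled (F5 α : PairFun n) (1 / 2) :=
  (controlled_F3 hα).of_le
    (fun x y u v hu hv hux hvy i j _ => mix_le_mix
      (mul_le_mul (hux i) (hvy j) (hv j) ((hu i).trans (hux i)))
      (mul_le_mul (hux j) (hvy i) (hv i) ((hu j).trans (hux j))) hα)
    (fun x y hx hy i j _ =>
      rpow_mul_le_mix (mul_nonneg (hx i) (hy j)) (mul_nonneg (hx j) (hy i)) hα)
    (fun x hx i j _ => by
      simp only [F5, F3]
      rw [mul_comm (x j), mix_self, rpow_mul_rpow_one_sub (mul_nonneg (hx i) (hx j)) hα])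

theorem controlled_F6 (hα : α ∈ Set.Icc (0 : ℝ) 1) : Controlled (F6 α : PairFun n) α :=
  (controlled_F2 hα).of_le
    (fun x y u v hu hv hux hvy i j _ => mul_le_mul (mix_le_mix (hux i) (hvy i) hα)
      (mix_le_mix (hux j) (hvy j) hα) (mix_nonneg (hu j) (hv j) hα)
      (mix_nonneg ((hu i).trans (hux i)) ((hv i).trans (hvy i)) hα))
    (fun x y hx hy i j _ => (gm_mul_gm (hx i) (hy i) (hx j) (hy j) α).symm.le.trans
      (mul_le_mul (rpow_mul_le_mix (hx i) (hy i) hα) (rpow_mul_le_mix (hx j) (hy j) hα)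
        (gm_nonneg (hx j) (hy j) α) (mix_nonneg (hx i) (hy i) hα)))
    (fun x hx i j _ => by
      simp only [F6, F2]
      rw [mix_self, mix_self, rpow_mul_rpow_one_sub (mul_nonneg (hx i) (hx j)) hα])

theorem controlled_F7 (hα : α ∈ Set.Icc (0 : ℝ) 1) : Controlled (F7 α : PairFun n) (1 / 2) :=
  (controlled_F3 hα).of_le
    (fun x y u v hu hv hux hvy i j _ => mul_le_mul (mix_le_mix (hux i) (hvy i) hα)
      (mix_le_mix (hvy j) (hux j) hα) (mix_nonneg (hv j) (hu j) hα)
      (mix_nonneg ((hu i).trans (hux i)) ((hv i).trans (hvy i)) hα))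
    (fun x y hx hy i j _ => by
      simp only [F3, F7]
      rw [mul_comm (x j)]
      exact (gm_mul_gm (hx i) (hy i) (hy j) (hx j) α).symm.le.trans
        (mul_le_mul (rpow_mul_le_mix (hx i) (hy i) hα) (rpow_mul_le_mix (hy j) (hx j) hα)
          (gm_nonneg (hy j) (hx j) α) (mix_nonneg (hx i) (hy i) hα)))
    (fun x hx i j _ => by
      simp only [F7, F3]
      rw [mix_self, mix_self, mul_comm (x j),
        rpow_mul_rpow_one_sub (mul_nonneg (hx i) (hx j)) hα])

theorem controlled_F8 (hα : α ∈ Set.Icc (0 : ℝ) 1) (hβ : β ∈ Set.Icc (0 : ℝ) 1) :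
    Controlled (F8 α β : PairFun n) β := by
  have g0 : ∀ x y : Vec n, 0 ≤ x → 0 ≤ y → ∀ i, 0 ≤ gm β (x i) (y i) := fun x y hx hy i =>
    gm_nonneg (hx i) (hy i) β
  have key : ∀ x y : Vec n, 0 ≤ x → 0 ≤ y → ∀ i j (hij : i ≠ j),
      (F8 α β : PairFun n) x y ⟨(i, j), hij⟩ * F8 α β x y ⟨(j, i), hij.symm⟩ =
        gm β (x i) (y i) * gm β (x j) (y j) := fun x y hx hy i j hij =>
    gm_mul_swap (g0 x y hx hy i) (g0 x y hx hy j) hα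
  refine ⟨⟨fun x y hx hy s => gm_nonneg (g0 x y hx hy _) (g0 x y hx hy _) α,
    fun x y u v hu hv hux hvy s => gm_le_gm (g0 u v hu hv _) (g0 u v hu hv _)
      (gm_le_gm (hu _) (hv _) (hux _) (hvy _) hβ) (gm_le_gm (hu _) (hv _) (hux _) (hvy _) hβ) hα⟩,
    1, fun i j hij => ⟨fun x y hx hy => le_of_eq ?_, fun x hx => ?_⟩⟩
  · rw [key x y hx hy, pow_one]; rfl
  · rw [key x x hx hx, pow_one, gm, gm, rpow_mul_rpow_one_sub (hx i) hβ,
      rpow_mul_rpow_one_sub (hx j) hβ]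

/-- Regrouping the product over (i, j) and (j, i) by index leaves at each index a mean of weight α
of two opposite means of weight β. By `gm_gm_swap` this is a single mean of weight αβ + (1-α)(1-β).
-/
theorem controlled_F9 (hα : α ∈ Set.Icc (0 : ℝ) 1) (hβ : β ∈ Set.Icc (0 : ℝ) 1) :
    Controlled (F9 α β : PairFun n) (1 - α - β + 2 * α * β) := by
  have g0 : ∀ x y : Vec n, 0 ≤ x → 0 ≤ y → ∀ i, 0 ≤ gm β (x i) (y i) := fun x y hx hy i =>
    gm_nonneg (hx i) (hy i) β
  have key : ∀ x y : Vec n, 0 ≤ x → 0 ≤ y → ∀ i j (hij : i ≠ j),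
      (F9 α β : PairFun n) x y ⟨(i, j), hij⟩ * F9 α β x y ⟨(j, i), hij.symm⟩ =
        gm α (gm β (x i) (y i)) (gm β (y i) (x i)) *
          gm α (gm β (x j) (y j)) (gm β (y j) (x j)) := fun x y hx hy i j hij => by
    simp only [F9, gm]; ring
  refine ⟨⟨fun x y hx hy s => gm_nonneg (g0 x y hx hy _) (g0 y x hy hx _) α,
    fun x y u v hu hv hux hvy s => gm_le_gm (g0 u v hu hv _) (g0 v u hv hu _)
      (gm_le_gm (hu _) (hv _) (hux _) (hvy _) hβ) (gm_le_gm (hv _) (hu _) (hvy _) (hux _) hβ) hα⟩,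
    1, fun i j hij => ⟨fun x y hx hy => le_of_eq ?_, fun x hx => ?_⟩⟩
  · rw [key x y hx hy, pow_one, gm_gm_swap (hx i) (hy i) hα hβ, gm_gm_swap (hx j) (hy j) hα hβ]
    rfl
  · have h1 : ∀ i, gm β (x i) (x i) = x i := fun i => rpow_mul_rpow_one_sub (hx i) hβ
    have h2 : ∀ i, gm α (x i) (x i) = x i := fun i => rpow_mul_rpow_one_sub (hx i) hα
    rw [key x x hx hx, pow_one, h1, h1, h2, h2]

/-- Commuting the two geometric means in F8 brings the one of weight β to the outside, where AM-GM
turns it into the sum F10. -/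
theorem controlled_F10 (hα : α ∈ Set.Icc (0 : ℝ) 1) (hβ : β ∈ Set.Icc (0 : ℝ) 1) :
    Controlled (F10 α β : PairFun n) β :=
  (controlled_F8 hα hβ).of_le
    (fun x y u v hu hv hux hvy i j _ => mix_le_mix (gm_le_gm (hu i) (hu j) (hux i) (hux j) hα)
      (gm_le_gm (hv i) (hv j) (hvy i) (hvy j) hα) hβ)
    (fun x y hx hy i j _ => by
      have h := rpow_mul_le_mix (gm_nonneg (hx i) (hx j) α) (gm_nonneg (hy i) (hy j) α) hβ
      refine le_trans (le_of_eq ?_) h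
      exact gm_gm_comm (hx i) (hy i) (hx j) (hy j))
    (fun x hx i j _ => by
      simp only [F10, F8]
      rw [mix_self, rpow_mul_rpow_one_sub (hx i) hβ, rpow_mul_rpow_one_sub (hx j) hβ])

theorem controlled_F11 (hα : α ∈ Set.Icc (0 : ℝ) 1) (hβ : β ∈ Set.Icc (0 : ℝ) 1) :
    Controlled (F11 α β : PairFun n) (1 - α - β + 2 * α * β) :=
  (controlled_F9 hα hβ).of_le
    (fun x y u v hu hv hux hvy i j _ => mix_le_mix (gm_le_gm (hu i) (hv j) (hux i) (hvy j) hα)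
      (gm_le_gm (hv i) (hu j) (hvy i) (hux j) hα) hβ)
    (fun x y hx hy i j _ => by
      have h := rpow_mul_le_mix (gm_nonneg (hx i) (hy j) α) (gm_nonneg (hy i) (hx j) α) hβ
      refine le_trans (le_of_eq ?_) h
      exact gm_gm_comm (hx i) (hy i) (hy j) (hx j))
    (fun x hx i j _ => by
      simp only [F11, F9]
      rw [mix_self, rpow_mul_rpow_one_sub (hx i) hβ, rpow_mul_rpow_one_sub (hx j) hβ])

theorem controlled_F12 (hα : α ∈ Set.Icc (0 : ℝ) 1) (hβ : β ∈ Set.Icc (0 : ℝ) 1) :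
    Controlled (F12 α β : PairFun n) β :=
  (controlled_F8 hα hβ).of_le
    (fun x y u v hu hv hux hvy i j _ => gm_le_gm (mix_nonneg (hu i) (hv i) hβ)
      (mix_nonneg (hu j) (hv j) hβ) (mix_le_mix (hux i) (hvy i) hβ)
      (mix_le_mix (hux j) (hvy j) hβ) hα)
    (fun x y hx hy i j _ => gm_le_gm (gm_nonneg (hx i) (hy i) β) (gm_nonneg (hx j) (hy j) β)
      (rpow_mul_le_mix (hx i) (hy i) hβ) (rpow_mul_le_mix (hx j) (hy j) hβ) hα)
    (fun x hx i j _ => by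
      simp only [F12, F8]
      rw [mix_self, mix_self, rpow_mul_rpow_one_sub (hx i) hβ, rpow_mul_rpow_one_sub (hx j) hβ])

theorem controlled_F13 (hα : α ∈ Set.Icc (0 : ℝ) 1) (hβ : β ∈ Set.Icc (0 : ℝ) 1) :
    Controlled (F13 α β : PairFun n) (1 - α - β + 2 * α * β) :=
  (controlled_F9 hα hβ).of_le
    (fun x y u v hu hv hux hvy i j _ => gm_le_gm (mix_nonneg (hu i) (hv i) hβ)
      (mix_nonneg (hv j) (hu j) hβ) (mix_le_mix (hux i) (hvy i) hβ)
      (mix_le_mix (hvy j) (hux j) hβ) hα)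
    (fun x y hx hy i j _ => gm_le_gm (gm_nonneg (hx i) (hy i) β) (gm_nonneg (hy j) (hx j) β)
      (rpow_mul_le_mix (hx i) (hy i) hβ) (rpow_mul_le_mix (hy j) (hx j) hβ) hα)
    (fun x hx i j _ => by
      simp only [F13, F9]
      rw [mix_self, mix_self, rpow_mul_rpow_one_sub (hx i) hβ, rpow_mul_rpow_one_sub (hx j) hβ])

/-- The weight is αβ + (1-α)(1-β), and its complement to 1 is α(1-β) + (1-α)β. -/
theorem mixed_weight_mem_Icc (hα : α ∈ Set.Icc (0 : ℝ) 1) (hβ : β ∈ Set.Icc (0 : ℝ) 1) :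
    1 - α - β + 2 * α * β ∈ Set.Icc (0 : ℝ) 1 := by
  obtain ⟨⟨a0, a1⟩, b0, b1⟩ := And.intro hα hβ
  constructor <;>
    nlinarith [mul_nonneg a0 b0, mul_nonneg (sub_nonneg.2 a1) (sub_nonneg.2 b1),
      mul_nonneg a0 (sub_nonneg.2 b1), mul_nonneg (sub_nonneg.2 a1) b0]

/-! ### Weights of the families, and their reduction to F1 at β = 0 and β = 1 -/

theorem exists_controlled_of_mem_thirteen (hα : α ∈ Set.Icc (0 : ℝ) 1)
    (hβ : β ∈ Set.Icc (0 : ℝ) 1) {F : PairFun n} (hF : F ∈ thirteen n α β) :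
    ∃ γ ∈ Set.Icc (0 : ℝ) 1, Controlled F γ := by
  have half : (1 / 2 : ℝ) ∈ Set.Icc (0 : ℝ) 1 := by norm_num
  have mixed := mixed_weight_mem_Icc hα hβ
  rcases hF with rfl | rfl | rfl | rfl | rfl | rfl | rfl | rfl | rfl | rfl | rfl | rfl | rfl
  · exact ⟨_, hα, controlled_F1 hα⟩
  · exact ⟨_, hα, controlled_F2 hα⟩
  · exact ⟨_, half, controlled_F3 hα⟩
  · exact ⟨_, hα, controlled_F4 hα⟩
  · exact ⟨_, half, controlled_F5 hα⟩
  · exact ⟨_, hα, controlled_F6 hα⟩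
  · exact ⟨_, half, controlled_F7 hα⟩
  · exact ⟨_, hβ, controlled_F8 hα hβ⟩
  · exact ⟨_, mixed, controlled_F9 hα hβ⟩
  · exact ⟨_, hβ, controlled_F10 hα hβ⟩
  · exact ⟨_, mixed, controlled_F11 hα hβ⟩
  · exact ⟨_, hβ, controlled_F12 hα hβ⟩
  · exact ⟨_, mixed, controlled_F13 hα hβ⟩

theorem controlled_of_mem_F1246 (hα : α ∈ Set.Icc (0 : ℝ) 1) {F : PairFun n}
    (hF : F ∈ ({F1 α, F2 α, F4 α, F6 α} : Set (PairFun n))) : Controlled F α := by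
  rcases hF with rfl | rfl | rfl | rfl
  exacts [controlled_F1 hα, controlled_F2 hα, controlled_F4 hα, controlled_F6 hα]

theorem controlled_of_mem_F357 (hα : α ∈ Set.Icc (0 : ℝ) 1) {F : PairFun n}
    (hF : F ∈ ({F3 α, F5 α, F7 α} : Set (PairFun n))) : Controlled F (1 / 2) := by
  rcases hF with rfl | rfl | rfl
  exacts [controlled_F3 hα, controlled_F5 hα, controlled_F7 hα]

theorem controlled_of_mem_F8_10_12 (hα : α ∈ Set.Icc (0 : ℝ) 1) (hβ : β ∈ Set.Icc (0 : ℝ) 1)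
    {F : PairFun n} (hF : F ∈ ({F8 α β, F10 α β, F12 α β} : Set (PairFun n))) :
    Controlled F β := by
  rcases hF with rfl | rfl | rfl
  exacts [controlled_F8 hα hβ, controlled_F10 hα hβ, controlled_F12 hα hβ]

theorem controlled_of_mem_F9_11_13 (hα : α ∈ Set.Icc (0 : ℝ) 1) (hβ : β ∈ Set.Icc (0 : ℝ) 1)
    {F : PairFun n} (hF : F ∈ ({F9 α β, F11 α β, F13 α β} : Set (PairFun n))) :
    Controlled F (1 - α - β + 2 * α * β) := by
  rcases hF with rfl | rfl | rfl
  exacts [controlled_F9 hα hβ, controlled_F11 hα hβ, controlled_F13 hα hβ]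

/-- Used at β = 0 and β = 1, where the one-parameter functions are taken at the same value as the
second parameter of F8, F10, F12, so that all seven share one weight. -/
theorem controlled_of_mem_seven (hα : α ∈ Set.Icc (0 : ℝ) 1) (hβ : β ∈ Set.Icc (0 : ℝ) 1)
    {F : PairFun n} (hF : F ∈ ({F1 β, F2 β, F4 β, F6 β, F8 α β, F10 α β, F12 α β} :
      Set (PairFun n))) : Controlled F β := by
  rcases hF with h | h | h | h | h
  · exact controlled_of_mem_F1246 hβ (Or.inl h)
  · exact controlled_of_mem_F1246 hβ (Or.inr (Or.inl h))
  · exact controlled_of_mem_F1246 hβ (Or.inr (Or.inr (Or.inl h)))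
  · exact controlled_of_mem_F1246 hβ (Or.inr (Or.inr (Or.inr h)))
  · exact controlled_of_mem_F8_10_12 hα hβ h

theorem eq_F1_of_mem_F9_11_13 {F : PairFun n}
    (hF : F ∈ ({F9 α 1, F11 α 1, F13 α 1} : Set (PairFun n))) : F = F1 α := by
  rcases hF with rfl | rfl | rfl <;> funext x y ⟨⟨i, j⟩, hij⟩ <;> simp [F1, F9, F11, F13]

theorem eq_swap_F1_of_mem_F9_11_13 {F : PairFun n}
    (hF : F ∈ ({F9 α 0, F11 α 0, F13 α 0} : Set (PairFun n))) : F = fun x y => F1 α y x := by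
  rcases hF with rfl | rfl | rfl <;> funext x y ⟨⟨i, j⟩, hij⟩ <;> simp [F1, F9, F11, F13]

end

end GPairs

/-! ### The clauses of the theorem, read off from the weights -/

theorem theorem3p4 (n : ℕ) (hn : 2 ≤ n) (α β : ℝ)
    (hα : α ∈ Set.Icc (0 : ℝ) 1) (hβ : β ∈ Set.Icc (0 : ℝ) 1) :
    -- the thirteen functions are monotonic, and the inclusions are proper
    (∀ F ∈ GPairs.thirteen n α β, GPairs.IsMonotonic F ∧
      GPairs.GFun n ×ˢ GPairs.GFun n ⊂ GPairs.GPairSet F) ∧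
    -- explicit pairs, `F₁, F₂, F₄, F₆`
    (0 < α → α < 1 →
      ∀ F ∈ ({GPairs.F1 α, GPairs.F2 α, GPairs.F4 α, GPairs.F6 α} : Set (GPairs.PairFun n)),
        (GPairs.scaledRowSum (-1 / α), GPairs.scaledRowSum (1 / (1 - α))) ∈
          GPairs.GPairSet F \ GPairs.GFun n ×ˢ GPairs.GFun n) ∧
    (GPairs.FFun n \ GPairs.GFun n).Nonempty ∧
    (∀ g ∈ GPairs.GFun n, ∀ h₀ ∈ GPairs.FFun n \ GPairs.GFun n,
      (∀ F ∈ ({GPairs.F1 1, GPairs.F2 1, GPairs.F4 1, GPairs.F6 1,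
          GPairs.F8 α 1, GPairs.F10 α 1, GPairs.F12 α 1} : Set (GPairs.PairFun n)),
        (g, h₀) ∈ GPairs.GPairSet F \ GPairs.GFun n ×ˢ GPairs.GFun n) ∧
      (∀ F ∈ ({GPairs.F1 0, GPairs.F2 0, GPairs.F4 0, GPairs.F6 0,
          GPairs.F8 α 0, GPairs.F10 α 0, GPairs.F12 α 0} : Set (GPairs.PairFun n)),
        (h₀, g) ∈ GPairs.GPairSet F \ GPairs.GFun n ×ˢ GPairs.GFun n)) ∧
    -- explicit pairs, `F₈, F₁₀, F₁₂`
    (0 < β → β < 1 →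
      ∀ F ∈ ({GPairs.F8 α β, GPairs.F10 α β, GPairs.F12 α β} : Set (GPairs.PairFun n)),
        (GPairs.scaledRowSum (-1 / β), GPairs.scaledRowSum (1 / (1 - β))) ∈
          GPairs.GPairSet F \ GPairs.GFun n ×ˢ GPairs.GFun n) ∧
    -- explicit pairs, `F₃, F₅, F₇`
    (∀ F ∈ ({GPairs.F3 α, GPairs.F5 α, GPairs.F7 α} : Set (GPairs.PairFun n)),
      (GPairs.scaledRowSum (-1), GPairs.scaledRowSum 1) ∈
        GPairs.GPairSet F \ GPairs.GFun n ×ˢ GPairs.GFun n) ∧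
    -- explicit pairs, `F₉, F₁₁, F₁₃`
    (0 < β → β < 1 →
      ∀ F ∈ ({GPairs.F9 α β, GPairs.F11 α β, GPairs.F13 α β} : Set (GPairs.PairFun n)),
        (GPairs.scaledRowSum (-GPairs.eta α β), GPairs.scaledRowSum 1) ∈
          GPairs.GPairSet F \ GPairs.GFun n ×ˢ GPairs.GFun n) ∧
    (∀ F ∈ ({GPairs.F9 α 1, GPairs.F11 α 1, GPairs.F13 α 1} : Set (GPairs.PairFun n)),
      GPairs.GPairSet F = GPairs.GPairSet (GPairs.F1 α : GPairs.PairFun n)) ∧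
    (∀ F ∈ ({GPairs.F9 α 0, GPairs.F11 α 0, GPairs.F13 α 0} : Set (GPairs.PairFun n)),
      GPairs.GPairSet F =
        GPairs.GPairSet (fun x y => (GPairs.F1 α : GPairs.PairFun n) y x)) ∧
    (0 < α → α < 1 →
      ∀ F ∈ ({GPairs.F9 α 0, GPairs.F11 α 0, GPairs.F13 α 0} : Set (GPairs.PairFun n)),
        (GPairs.scaledRowSum (1 / (1 - α)), GPairs.scaledRowSum (-1 / α)) ∈
          GPairs.GPairSet F \ GPairs.GFun n ×ˢ GPairs.GFun n) ∧
    (∀ g ∈ GPairs.GFun n, ∀ h₀ ∈ GPairs.FFun n \ GPairs.GFun n,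
      (∀ F ∈ ({GPairs.F9 1 0, GPairs.F11 1 0, GPairs.F13 1 0} : Set (GPairs.PairFun n)),
        (h₀, g) ∈ GPairs.GPairSet F \ GPairs.GFun n ×ˢ GPairs.GFun n) ∧
      (∀ F ∈ ({GPairs.F9 0 0, GPairs.F11 0 0, GPairs.F13 0 0} : Set (GPairs.PairFun n)),
        (g, h₀) ∈ GPairs.GPairSet F \ GPairs.GFun n ×ˢ GPairs.GFun n)) ∧
    -- all pairs of the row and column sum functions are pairs for all thirteen functions
    (∀ x y : GPairs.Vec n, (∀ i, 0 < x i) → (∀ i, 0 < y i) →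
      ∀ g ∈ GPairs.sumFunctions x y, ∀ h ∈ GPairs.sumFunctions x y,
        ∀ F ∈ GPairs.thirteen n α β, (g, h) ∈ GPairs.GPairSet F) := by
  have h0 : (0 : ℝ) ∈ Set.Icc (0 : ℝ) 1 := by norm_num
  have h1 : (1 : ℝ) ∈ Set.Icc (0 : ℝ) 1 := by norm_num
  refine ⟨fun F hF => ?_, fun a0 a1 F hF => ?_, GPairs.FFun_diff_GFun_nonempty hn,
    fun g hg h₀ hh => ⟨fun F hF => ?_, fun F hF => ?_⟩, fun b0 b1 F hF => ?_, fun F hF => ?_,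
    fun b0 b1 F hF => ?_, fun F hF => ?_, fun F hF => ?_, fun a0 a1 F hF => ?_,
    fun g hg h₀ hh => ⟨fun F hF => ?_, fun F hF => ?_⟩, fun x y hx hy g hg h hh F hF => ?_⟩
  · obtain ⟨γ, hγ, hc⟩ := GPairs.exists_controlled_of_mem_thirteen hα hβ hF
    exact ⟨hc.mono, hc.prod_ssubset hn hγ⟩
  · refine (GPairs.controlled_of_mem_F1246 hα hF).scaledRowSum_mem hn ?_
      (Or.inl (div_neg_of_neg_of_pos (by norm_num) a0))
    rw [div_mul_cancel₀ _ a0.ne', div_mul_cancel₀ _ (sub_pos.2 a1).ne']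
    norm_num
  · exact (GPairs.controlled_of_mem_seven hα h1 hF).left_mem hn rfl hg hh
  · exact (GPairs.controlled_of_mem_seven hα h0 hF).right_mem hn rfl hg hh
  · refine (GPairs.controlled_of_mem_F8_10_12 hα hβ hF).scaledRowSum_mem hn ?_
      (Or.inl (div_neg_of_neg_of_pos (by norm_num) b0))
    rw [div_mul_cancel₀ _ b0.ne', div_mul_cancel₀ _ (sub_pos.2 b1).ne']
    norm_num
  · exact (GPairs.controlled_of_mem_F357 hα hF).scaledRowSum_mem hn (by norm_num)
      (Or.inl (by norm_num))
  -- With γ the weight of F9, F11, F13, the numerator of η is 1 - γ and the denominator is γ, so η =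
  -- (1-γ)/γ is the exponent that compensates `scaledRowSum 1`.
  · have hnum : 0 < α + β - 2 * α * β := by
      rcases hα.1.eq_or_lt with rfl | a0
      · linarith
      · nlinarith [mul_pos a0 (sub_pos.2 b1), mul_nonneg (sub_nonneg.2 hα.2) b0.le]
    have hden : 0 < 1 - α - β + 2 * α * β := by
      rcases hα.1.eq_or_lt with rfl | a0
      · linarith
      · nlinarith [mul_pos a0 b0, mul_nonneg (sub_nonneg.2 hα.2) (sub_nonneg.2 b1.le)]
    refine (GPairs.controlled_of_mem_F9_11_13 hα hβ hF).scaledRowSum_mem hn ?_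
      (Or.inl (neg_neg_of_pos (div_pos hnum hden)))
    rw [GPairs.eta, neg_mul, div_mul_cancel₀ _ hden.ne']
    ring
  · rw [GPairs.eq_F1_of_mem_F9_11_13 hF]
  · rw [GPairs.eq_swap_F1_of_mem_F9_11_13 hF]
  -- At β = 0 the weight is 1 - α, so the two exponents change places and the second one is
  -- negative.
  · have a1' : 1 - α ≠ 0 := (sub_pos.2 a1).ne'
    refine (GPairs.controlled_of_mem_F9_11_13 hα h0 hF).scaledRowSum_mem hn ?_
      (Or.inr (div_neg_of_neg_of_pos (by norm_num) a0))
    field_simp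
    ring
  -- The mixed weight equals 0 at (α, β) = (1, 0) and 1 at (0, 0).
  · exact (GPairs.controlled_of_mem_F9_11_13 h1 h0 hF).right_mem hn (by norm_num) hg hh
  · exact (GPairs.controlled_of_mem_F9_11_13 h0 h0 hF).left_mem hn (by norm_num) hg hh
  · obtain ⟨γ, hγ, hc⟩ := GPairs.exists_controlled_of_mem_thirteen hα hβ hF
    have hsub := GPairs.sumFunctions_subset_GFun hx hy
    exact hc.prod_subset hn hγ ⟨hsub hg, hsub hh⟩
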